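/- For $r>0$ let $B^{2n}(r)=\{(x,y)\in\mathbb{R}^n\times\mathbb{R}^n : \sum_i x_i^2+\sum_i y_i^2< r/\pi\}$ and $Z^{2n}(r)=\{(x,y) : x_1^2+y_1^2<r/\pi\}=B^2(r)\times\mathbb{R}^{2n-2}$, both with the standard symplectic form $\omega_0=\sum_i dy_i\wedge dx_i$. A symplectic capacity $c$ on symplectic manifolds of dimension $2n$ (without boundary) assigns to each of them a number $c(M,\omega)\in[0,\infty]$ such that - (monotonicity) $c(M_1,\omega_1)\le c(M_2,\omega_2)$ whenever there is a symplectic embedding of $(M_1,\omega_1)$ into $(M_2,\omega_2)$ (of the same dimension); - (conformality) $c(M,\lambda\omega)=|\lambda|\,c(M,\omega)$ for all real $\lambda\ne0$; - (non-triviality) $c(B^{2n}(1),\omega_0)>0$ and $c(Z^{2n}(1),\omega_0)<\infty$. It is normalized if $c(B^{2n}(1),\omega_0)=c(Z^{2n}(1),\omega_0)=1$. For $a>0$ let $C_a=\{q\in\mathbb{R}^3 : q_1^2+q_2^2=1,\ |q_3|<a\}$ be the truncated cylinder with the Riemannian metric induced from $\mathbb{R}^3$, and let $$D^*C_a=\{(q,p)\in\mathbb{R}^3\times\mathbb{R}^3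 : q\in C_a,\ q_1p_1+q_2p_2=0,\ |p|^2<1\}$$ be its open unit disk cotangent bundle, a $4$-dimensional submanifold of $T^*\mathbb{R}^3=\mathbb{R}^3\times\mathbb{R}^3$ with the symplectic form given by the restriction of $\sum_i dp_i\wedge dq_i$. **Theorem.** For every normalized symplectic capacity $c$ on $4$-dimensional symplectic manifolds and every $a>0$, $$c(D^*C_a)=\begin{cases}4a & \text{if } a\le\pi,\\ 4\pi & \text{if } a\ge\pi.\end{cases}$$ -/

import Mathlib

open Set Topology
open scoped Manifold ContDiff ENNReal

/-- `ℝ^{2n}` with coordinates `(x, y)`, `x, y ∈ ℝ^n`. Only its topology and smooth structure matter. -/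
abbrev SympSpace (n : ℕ) : Type := (Fin n → ℝ) × (Fin n → ℝ)

/-- The standard symplectic form `ω₀ = ∑ dy_i ∧ dx_i` on `ℝ^{2n}`. -/
noncomputable def stdForm (n : ℕ) : SympSpace n [⋀^Fin 2]→L[ℝ] ℝ where
  toFun v := ∑ i, ((v 0).2 i * (v 1).1 i - (v 0).1 i * (v 1).2 i)
  map_update_add' := by
    intro _ m i x y
    have : ∀ h : DecidableEq (Fin 2), h = instDecidableEqFin 2 := fun h => Subsingleton.elim _ _
    rename_i h
    obtain rfl := this h
    rw [← Finset.sum_add_distrib]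
    refine Finset.sum_congr rfl fun j _ => ?_
    fin_cases i <;> simp <;> ring
  map_update_smul' := by
    intro _ m i c x
    have : ∀ h : DecidableEq (Fin 2), h = instDecidableEqFin 2 := fun h => Subsingleton.elim _ _
    rename_i h
    obtain rfl := this h
    rw [smul_eq_mul, Finset.mul_sum]
    refine Finset.sum_congr rfl fun j _ => ?_
    fin_cases i <;> simp <;> ring
  map_eq_zero_of_eq' := by
    intro v i j hij hne
    have h01 : v 0 = v 1 := by
      fin_cases i <;> fin_cases j <;> first | exact absurd rfl hne | exact hij | exact hij.symm
    refine Finset.sum_eq_zero fun k _ => ?_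
    rw [h01]; ring
  cont := by
    show Continuous fun v : Fin 2 → SympSpace n =>
      ∑ i, ((v 0).2 i * (v 1).1 i - (v 0).1 i * (v 1).2 i)
    fun_prop

theorem stdForm_apply (n : ℕ) (v : Fin 2 → SympSpace n) :
    stdForm n v = ∑ i, ((v 0).2 i * (v 1).1 i - (v 0).1 i * (v 1).2 i) := rfl

theorem stdForm_nondegenerate (n : ℕ) (v : SympSpace n) (hv : ∀ w, stdForm n ![v, w] = 0) :
    v = 0 := by
  simp only [stdForm_apply, Matrix.cons_val_zero, Matrix.cons_val_one] at hv
  ext i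
  · simpa [Pi.single_apply] using hv (0, Pi.single i 1)
  · simpa [Pi.single_apply] using hv (Pi.single i 1, 0)

/-- A `2`-form on a manifold `M` modelled on `ℝ^{2n}`: an alternating bilinear form on every tangent
space. Smoothness is part of `IsSymplecticForm`. -/
abbrev TwoForm (n : ℕ) (M : Type) [TopologicalSpace M] [ChartedSpace (SympSpace n) M] : Type :=
  ∀ x : M, TangentSpace 𝓘(ℝ, SympSpace n) x [⋀^Fin 2]→L[ℝ] ℝ

/-- The expression of a `2`-form in the chart around `x₀`, that is, its pullback under the inverse
of that chart. It is meaningful on the target of the chart. -/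
noncomputable def inChart {n : ℕ} {M : Type} [TopologicalSpace M]
    [ChartedSpace (SympSpace n) M] (Ω : TwoForm n M) (x₀ : M) (y : SympSpace n) :
    SympSpace n [⋀^Fin 2]→L[ℝ] ℝ :=
  (Ω ((extChartAt 𝓘(ℝ, SympSpace n) x₀).symm y)).compContinuousLinearMap
    (mfderiv 𝓘(ℝ, SympSpace n) 𝓘(ℝ, SympSpace n) (extChartAt 𝓘(ℝ, SympSpace n) x₀).symm y)

/-- A symplectic form: a smooth, closed, nondegenerate `2`-form. Smoothness and closedness are
expressed in the charts; the charts around the points cover the manifold. -/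
structure IsSymplecticForm {n : ℕ} {M : Type} [TopologicalSpace M]
    [ChartedSpace (SympSpace n) M] (Ω : TwoForm n M) : Prop where
  smooth : ∀ x₀ : M, ContDiffOn ℝ ∞ (inChart Ω x₀) (extChartAt 𝓘(ℝ, SympSpace n) x₀).target
  closed : ∀ x₀ : M, ∀ y ∈ (extChartAt 𝓘(ℝ, SympSpace n) x₀).target,
    extDeriv (inChart Ω x₀) y = 0
  nondegenerate : ∀ (x : M) (v : TangentSpace 𝓘(ℝ, SympSpace n) x),
    (∀ w, Ω x ![v, w] = 0) → v = 0

/-- A symplectic manifold `(M, Ω)` of dimension `2n` (without boundary): a smooth, Hausdorff, second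
countable manifold modelled on `ℝ^{2n}` with a symplectic form. It may be disconnected. -/
structure SymplecticManifold (n : ℕ) where
  carrier : Type
  [topologicalSpace : TopologicalSpace carrier]
  [chartedSpace : ChartedSpace (SympSpace n) carrier]
  [isManifold : IsManifold 𝓘(ℝ, SympSpace n) ∞ carrier]
  [t2Space : T2Space carrier]
  [secondCountable : SecondCountableTopology carrier]
  form : TwoForm n carrier
  isSymplectic : IsSymplecticForm form

attribute [instance] SymplecticManifold.topologicalSpace SymplecticManifold.chartedSpace
  SymplecticManifold.isManifold SymplecticManifold.t2Space SymplecticManifold.secondCountable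

/-- The pullback `f^*ω₀` of the standard symplectic form of `ℝ^{2m}` under `f : M → ℝ^{2m}`. -/
noncomputable def pullbackStdForm {n m : ℕ} {M : Type} [TopologicalSpace M]
    [ChartedSpace (SympSpace n) M] (f : M → SympSpace m) : TwoForm n M := fun x =>
  (stdForm m).compContinuousLinearMap
    (mfderiv 𝓘(ℝ, SympSpace n) 𝓘(ℝ, SympSpace m) f x : TangentSpace 𝓘(ℝ, SympSpace n) x →L[ℝ] SympSpace m)

theorem contDiff_pullback_two {E F : Type*} [NormedAddCommGroup E] [NormedSpace ℝ E]
    [NormedAddCommGroup F] [NormedSpace ℝ F] (α : F [⋀^Fin 2]→L[ℝ] ℝ) :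
    ContDiff ℝ ∞ (fun A : E →L[ℝ] F => α.compContinuousLinearMap A) := by
  let L₀ : ContinuousMultilinearMap ℝ (fun _ : Fin 2 => E) ℝ →ₗ[ℝ] E [⋀^Fin 2]→L[ℝ] ℝ :=
    { toFun := fun f => (2 : ℝ)⁻¹ • ContinuousMultilinearMap.alternatization f
      map_add' := fun f g => by simp
      map_smul' := fun c f => by
        ext v
        simp [ContinuousMultilinearMap.alternatization_apply_apply, Finset.mul_sum]
        refine Finset.sum_congr rfl fun σ _ => ?_
        simp only [Units.smul_def, zsmul_eq_mul]
        ring }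
  have hL : ∀ f, ‖L₀ f‖ ≤ 1 * ‖f‖ := by
    intro f
    rw [one_mul]
    refine ContinuousAlternatingMap.opNorm_le_bound _ (norm_nonneg f) fun v => ?_
    have h1 : ∀ σ : Equiv.Perm (Fin 2), ‖f (v ∘ σ)‖ ≤ ‖f‖ * ∏ i, ‖v i‖ := fun σ => by
      refine (f.le_opNorm _).trans_eq ?_
      congr 1
      exact Equiv.prod_comp σ (fun i => ‖v i‖)
    show ‖(2 : ℝ)⁻¹ • ContinuousMultilinearMap.alternatization f v‖ ≤ _
    rw [ContinuousMultilinearMap.alternatization_apply_apply, norm_smul]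
    have h2 : ‖∑ σ : Equiv.Perm (Fin 2), Equiv.Perm.sign σ • f (v ∘ σ)‖
        ≤ ∑ σ : Equiv.Perm (Fin 2), ‖f‖ * ∏ i, ‖v i‖ := by
      refine norm_sum_le_of_le _ fun σ _ => ?_
      rcases Int.units_eq_one_or (Equiv.Perm.sign σ) with h | h <;> rw [h] <;>
        simpa using h1 σ
    rw [Finset.sum_const, Finset.card_univ, Fintype.card_perm] at h2
    simp at h2 ⊢
    linarith
  let L := L₀.mkContinuous 1 hL
  have key : (fun A : E →L[ℝ] F => α.compContinuousLinearMap A) = fun A =>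
      L (ContinuousMultilinearMap.compContinuousLinearMapContinuousMultilinear ℝ
        (fun _ : Fin 2 => E) (fun _ => F) ℝ (fun _ => A) α.toContinuousMultilinearMap) := by
    funext A
    ext v
    show _ = (2 : ℝ)⁻¹ • ContinuousMultilinearMap.alternatization
      (ContinuousMultilinearMap.compContinuousLinearMapContinuousMultilinear ℝ
        (fun _ : Fin 2 => E) (fun _ => F) ℝ (fun _ => A) α.toContinuousMultilinearMap) v
    rw [ContinuousMultilinearMap.alternatization_apply_apply]
    have h3 : ∀ σ : Equiv.Perm (Fin 2), Equiv.Perm.sign σ •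
        ((ContinuousMultilinearMap.compContinuousLinearMapContinuousMultilinear ℝ
        (fun _ : Fin 2 => E) (fun _ => F) ℝ (fun _ => A) α.toContinuousMultilinearMap) (v ∘ σ))
        = α (A ∘ v) := by
      intro σ
      have : ((ContinuousMultilinearMap.compContinuousLinearMapContinuousMultilinear ℝ
        (fun _ : Fin 2 => E) (fun _ => F) ℝ (fun _ => A) α.toContinuousMultilinearMap) (v ∘ σ))
        = α ((A ∘ v) ∘ σ) := rfl
      rw [this]
      erw [α.toAlternatingMap.map_perm (A ∘ v) σ]
      rw [smul_smul, Int.units_mul_self, one_smul]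
      rfl
    rw [Finset.sum_congr rfl fun σ _ => h3 σ, Finset.sum_const, Finset.card_univ,
      Fintype.card_perm]
    simp
  rw [key]
  refine L.contDiff.comp ?_
  have h4 : ContDiff ℝ ∞ (fun A : E →L[ℝ] F =>
      ContinuousMultilinearMap.compContinuousLinearMapContinuousMultilinear ℝ
        (fun _ : Fin 2 => E) (fun _ => F) ℝ (fun _ => A)) :=
    (ContinuousMultilinearMap.contDiff _).comp (contDiff_pi.2 fun _ => contDiff_id)
  exact h4.clm_apply contDiff_const

section
variable {n m : ℕ} {M : Type} [TopologicalSpace M] [ChartedSpace (SympSpace n) M]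
  [IsManifold 𝓘(ℝ, SympSpace n) ∞ M]

theorem pullbackStdForm_inChart {f : M → SympSpace m}
    (hf : ContMDiff 𝓘(ℝ, SympSpace n) 𝓘(ℝ, SympSpace m) ∞ f) (x₀ : M) {y : SympSpace n}
    (hy : y ∈ (extChartAt 𝓘(ℝ, SympSpace n) x₀).target) :
    inChart (pullbackStdForm f) x₀ y = (stdForm m).compContinuousLinearMap
      (fderiv ℝ (f ∘ (extChartAt 𝓘(ℝ, SympSpace n) x₀).symm) y) := by
  have h1 : MDifferentiableAt 𝓘(ℝ, SympSpace n) 𝓘(ℝ, SympSpace n)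
      (extChartAt 𝓘(ℝ, SympSpace n) x₀).symm y :=
    (((contMDiffOn_extChartAt_symm (n := ∞) x₀) y hy).contMDiffAt
      ((isOpen_extChartAt_target x₀).mem_nhds hy)).mdifferentiableAt (by simp)
  have h2 := mfderiv_comp y ((hf.mdifferentiable (by simp)) _) h1
  rw [← mfderiv_eq_fderiv, h2]
  rfl

theorem contDiffOn_comp_extChartAt_symm {f : M → SympSpace m}
    (hf : ContMDiff 𝓘(ℝ, SympSpace n) 𝓘(ℝ, SympSpace m) ∞ f) (x₀ : M) :
    ContDiffOn ℝ ∞ (f ∘ (extChartAt 𝓘(ℝ, SympSpace n) x₀).symm)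
      (extChartAt 𝓘(ℝ, SympSpace n) x₀).target :=
  contMDiffOn_iff_contDiffOn.1
    (hf.comp_contMDiffOn (contMDiffOn_extChartAt_symm (n := ∞) x₀))

theorem pullbackStdForm_isSymplectic {f : M → SympSpace m}
    (hf : ContMDiff 𝓘(ℝ, SympSpace n) 𝓘(ℝ, SympSpace m) ∞ f)
    (hnd : ∀ (x : M) (v : TangentSpace 𝓘(ℝ, SympSpace n) x),
      (∀ w, pullbackStdForm f x ![v, w] = 0) → v = 0) :
    IsSymplecticForm (pullbackStdForm f : TwoForm n M) where
  smooth x₀ := by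
    have h := (contDiffOn_comp_extChartAt_symm hf x₀).fderiv_of_isOpen (m := ∞)
      (isOpen_extChartAt_target x₀) (by simp)
    exact ((contDiff_pullback_two (stdForm m)).comp_contDiffOn h).congr
      fun y hy => pullbackStdForm_inChart hf x₀ hy
  closed x₀ y hy := by
    have hev : inChart (pullbackStdForm f) x₀ =ᶠ[𝓝 y] fun y =>
        ((fun _ => stdForm m : SympSpace m → _)
          ((f ∘ (extChartAt 𝓘(ℝ, SympSpace n) x₀).symm) y)).compContinuousLinearMap
        (fderiv ℝ (f ∘ (extChartAt 𝓘(ℝ, SympSpace n) x₀).symm) y) := by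
      filter_upwards [(isOpen_extChartAt_target x₀).mem_nhds hy] with z hz
      exact pullbackStdForm_inChart hf x₀ hz
    rw [hev.extDeriv_eq, extDeriv_pullback (r := ∞) (differentiableAt_const _)
      ((contDiffOn_comp_extChartAt_symm hf x₀).contDiffAt
        ((isOpen_extChartAt_target x₀).mem_nhds hy)) (by simp only [minSmoothness_of_isRCLikeNormedField]; exact WithTop.coe_le_coe.2 le_top)]
    ext v
    simp [extDeriv, ContinuousAlternatingMap.alternatizeUncurryFin_apply]
  nondegenerate := hnd

end

theorem pullbackStdForm_apply_chart {n m : ℕ} {M : Type} [TopologicalSpace M]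
    [ChartedSpace (SympSpace n) M] {f : M → SympSpace m}
    (hf : ContMDiff 𝓘(ℝ, SympSpace n) 𝓘(ℝ, SympSpace m) ∞ f) (x : M) :
    pullbackStdForm (n := n) f x = (stdForm m).compContinuousLinearMap
      (fderiv ℝ (f ∘ (extChartAt 𝓘(ℝ, SympSpace n) x).symm)
        (extChartAt 𝓘(ℝ, SympSpace n) x x)) := by
  have h : mfderiv 𝓘(ℝ, SympSpace n) 𝓘(ℝ, SympSpace m) f x =
      fderiv ℝ (f ∘ (extChartAt 𝓘(ℝ, SympSpace n) x).symm)
        (extChartAt 𝓘(ℝ, SympSpace n) x x) := by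
    have := (hf.mdifferentiable (by simp)) x
    simp [mfderiv, this, writtenInExtChartAt]
    rfl
  unfold pullbackStdForm
  rw [h]
  rfl

/-- An open subset of `ℝ^{2n}`, with the restriction of the standard symplectic form. -/
noncomputable def SymplecticManifold.ofOpen {n : ℕ} (U : TopologicalSpace.Opens (SympSpace n)) :
    SymplecticManifold n where
  carrier := U
  form := pullbackStdForm (Subtype.val : U → SympSpace n)
  isSymplectic := by
    have hval : ContMDiff 𝓘(ℝ, SympSpace n) 𝓘(ℝ, SympSpace n) ∞
      (Subtype.val : U → SympSpace n) := contMDiff_subtype_val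
    refine pullbackStdForm_isSymplectic hval fun x v hv => ?_
    have hd : MDifferentiableAt 𝓘(ℝ, SympSpace n) 𝓘(ℝ, SympSpace n)
        (Subtype.val : U → SympSpace n) x := (hval.mdifferentiable (by simp)) x
    have hfd : fderiv ℝ ((Subtype.val : U → SympSpace n) ∘
        (extChartAt 𝓘(ℝ, SympSpace n) x).symm) (extChartAt 𝓘(ℝ, SympSpace n) x x) =
        ContinuousLinearMap.id ℝ (SympSpace n) := by
      have hev : ((Subtype.val : U → SympSpace n) ∘ (extChartAt 𝓘(ℝ, SympSpace n) x).symm)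
          =ᶠ[𝓝 (extChartAt 𝓘(ℝ, SympSpace n) x x)] id := by
        filter_upwards [(isOpen_extChartAt_target x).mem_nhds (mem_extChartAt_target x)] with z hz
        have := (extChartAt 𝓘(ℝ, SympSpace n) x).right_inv hz
        exact this
      rw [hev.fderiv_eq, fderiv_id]
    rw [pullbackStdForm_apply_chart hval, hfd] at hv
    exact stdForm_nondegenerate n v fun w => hv w

theorem IsSymplecticForm.const_smul {n : ℕ} {M : Type} [TopologicalSpace M]
    [ChartedSpace (SympSpace n) M] {Ω : TwoForm n M} (h : IsSymplecticForm Ω) {l : ℝ}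
    (hl : l ≠ 0) : IsSymplecticForm (fun x => l • Ω x : TwoForm n M) := by
  have key : ∀ x₀ : M, inChart (fun x => l • Ω x : TwoForm n M) x₀ = l • inChart Ω x₀ :=
    fun x₀ => rfl
  refine ⟨fun x₀ => ?_, fun x₀ y hy => ?_, fun x v hv => h.nondegenerate x v fun w => ?_⟩
  · rw [key]
    exact (h.smooth x₀).const_smul l
  · rw [key, extDeriv_smul, h.closed x₀ y hy, smul_zero]
  · have := hv w
    rw [ContinuousAlternatingMap.smul_apply, smul_eq_mul] at this
    exact (mul_eq_zero.1 this).resolve_left hl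

/-- The symplectic manifold `(M, l Ω)`, for `l ≠ 0`. -/
noncomputable def SymplecticManifold.rescale {n : ℕ} (M : SymplecticManifold n) (l : ℝ)
    (hl : l ≠ 0) : SymplecticManifold n where
  carrier := M.carrier
  form x := l • M.form x
  isSymplectic := M.isSymplectic.const_smul hl

/-- `φ : M → N` is a symplectic embedding: a smooth topological embedding with `φ^*Ω_N = Ω_M`
(this identity makes `φ` an immersion). Both manifolds have the same dimension `2n`. -/
structure IsSymplecticEmbedding {n : ℕ} (M N : SymplecticManifold n)
    (φ : M.carrier → N.carrier) : Prop where
  contMDiff : ContMDiff 𝓘(ℝ, SympSpace n) 𝓘(ℝ, SympSpace n) ∞ φ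
  isEmbedding : IsEmbedding φ
  pullback_eq : ∀ x, (N.form (φ x)).compContinuousLinearMap
    (mfderiv 𝓘(ℝ, SympSpace n) 𝓘(ℝ, SympSpace n) φ x) = M.form x

/-- The ball `B^{2n}(r) = {∑ x_i² + ∑ y_i² < r / π}` with `ω₀`. -/
noncomputable def sympBall (n : ℕ) (r : ℝ) : SymplecticManifold n :=
  .ofOpen ⟨{v | ∑ i, v.1 i ^ 2 + ∑ i, v.2 i ^ 2 < r / Real.pi},
    isOpen_lt (by fun_prop) continuous_const⟩

/-- The symplectic cylinder `Z^{2n}(r) = B^2(r) × ℝ^{2n-2} = {x_1² + y_1² < r / π}` with `ω₀`. -/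
noncomputable def sympCylinder (n : ℕ) [NeZero n] (r : ℝ) : SymplecticManifold n :=
  .ofOpen ⟨{v | v.1 0 ^ 2 + v.2 0 ^ 2 < r / Real.pi},
    isOpen_lt (by fun_prop) continuous_const⟩

/-- A symplectic capacity on the symplectic manifolds of dimension `2n`. -/
structure IsSymplecticCapacity (n : ℕ) [NeZero n] (c : SymplecticManifold n → ℝ≥0∞) : Prop where
  monotone : ∀ M N : SymplecticManifold n, (∃ φ, IsSymplecticEmbedding M N φ) → c M ≤ c N
  conformal : ∀ (M : SymplecticManifold n) (l : ℝ) (hl : l ≠ 0),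
    c (M.rescale l hl) = ENNReal.ofReal |l| * c M
  ball_pos : 0 < c (sympBall n 1)
  cylinder_lt_top : c (sympCylinder n 1) < ⊤

/-- A normalized symplectic capacity: `c(B^{2n}(1)) = c(Z^{2n}(1)) = 1`. -/
structure IsNormalizedSymplecticCapacity (n : ℕ) [NeZero n] (c : SymplecticManifold n → ℝ≥0∞) : Prop
    extends IsSymplecticCapacity n c where
  ball_eq_one : c (sympBall n 1) = 1
  cylinder_eq_one : c (sympCylinder n 1) = 1

/-- The truncated cylinder `C_a = {q ∈ ℝ³ | q_1² + q_2² = 1, |q_3| < a}`. -/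
def truncatedCylinder (a : ℝ) : Set (Fin 3 → ℝ) :=
  {q | q 0 ^ 2 + q 1 ^ 2 = 1 ∧ |q 2| < a}

/-- The open unit disk cotangent bundle `D^*C_a` as a subset of `T^*ℝ³ = ℝ³ × ℝ³`, where covectors are
identified with tangent vectors through the metric of `C_a` induced from `ℝ³`: the pairs `(q, p)`
with `q ∈ C_a`, `p` tangent to `C_a` at `q` (orthogonal to the normal `(q_1, q_2, 0)`), `|p| < 1`. -/
def diskCotangentCylinder (a : ℝ) : Set (SympSpace 3) :=
  {x | x.1 ∈ truncatedCylinder a ∧ x.1 0 * x.2 0 + x.1 1 * x.2 1 = 0 ∧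
    x.2 0 ^ 2 + x.2 1 ^ 2 + x.2 2 ^ 2 < 1}

/-- The coordinates `(θ, z; p_θ, p_z)` on `D^*C_a`, with the angle `θ ∈ (-π, π]` measured from the
direction `w` of the unit circle. -/
noncomputable def cylCoord (w : ℂ) (x : SympSpace 3) : SympSpace 2 :=
  (![((⟨x.1 0, x.1 1⟩ : ℂ) * (starRingEnd ℂ) w).arg, x.1 2],
   ![x.1 0 * x.2 1 - x.1 1 * x.2 0, x.2 2])

/-- The inverse of `cylCoord w`: for `u = w e^{iθ}`, the point `q = (u, z)` with the covector
`p = p_θ · (i u, 0) + p_z · (0, 0, 1)`. -/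
noncomputable def cylParam (w : ℂ) (y : SympSpace 2) : SympSpace 3 :=
  (![w.re * Real.cos (y.1 0) - w.im * Real.sin (y.1 0),
     w.re * Real.sin (y.1 0) + w.im * Real.cos (y.1 0), y.1 1],
   ![-(y.2 0 * (w.re * Real.sin (y.1 0) + w.im * Real.cos (y.1 0))),
     y.2 0 * (w.re * Real.cos (y.1 0) - w.im * Real.sin (y.1 0)), y.2 1])

theorem contDiff_cylParam (w : ℂ) : ContDiff ℝ ∞ (cylParam w) := by
  unfold cylParam
  refine ContDiff.prodMk (contDiff_pi.2 fun i => ?_) (contDiff_pi.2 fun i => ?_) <;>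
    fin_cases i <;> simp <;> fun_prop

theorem contDiffAt_cylCoord (w : ℂ) {x : SympSpace 3}
    (hx : (⟨x.1 0, x.1 1⟩ : ℂ) * (starRingEnd ℂ) w ∈ Complex.slitPlane) :
    ContDiffAt ℝ ∞ (cylCoord w) x := by
  have h0 : ContDiff ℝ ∞ fun x : SympSpace 3 => (⟨x.1 0, x.1 1⟩ : ℂ) * (starRingEnd ℂ) w := by
    have : (fun x : SympSpace 3 => (⟨x.1 0, x.1 1⟩ : ℂ) * (starRingEnd ℂ) w) =
        fun x => (Complex.ofRealCLM (x.1 0) + Complex.ofRealCLM (x.1 1) * Complex.I)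
          * (starRingEnd ℂ) w := by
      funext x; congr 1; apply Complex.ext <;> simp
    rw [this]
    have h1 : ContDiff ℝ ∞ fun x : SympSpace 3 => Complex.ofRealCLM (x.1 0) :=
      Complex.ofRealCLM.contDiff.comp (by fun_prop)
    have h2 : ContDiff ℝ ∞ fun x : SympSpace 3 => Complex.ofRealCLM (x.1 1) :=
      Complex.ofRealCLM.contDiff.comp (by fun_prop)
    exact (h1.add (h2.mul contDiff_const)).mul contDiff_const
  have h1 : ContDiffAt ℝ ∞
      (fun x : SympSpace 3 => ((⟨x.1 0, x.1 1⟩ : ℂ) * (starRingEnd ℂ) w).arg) x := by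
    have h2 : ContDiffAt ℝ ∞ Complex.log ((⟨x.1 0, x.1 1⟩ : ℂ) * (starRingEnd ℂ) w) :=
      (Complex.contDiffAt_log hx).restrict_scalars ℝ
    have h3 := (Complex.imCLM.contDiff (n := ∞)).contDiffAt.comp x
      (h2.comp x h0.contDiffAt)
    refine h3.congr_of_eventuallyEq (Filter.Eventually.of_forall fun z => ?_)
    simp [Complex.log_im]
  unfold cylCoord
  refine ContDiffAt.prodMk (contDiffAt_pi.2 fun i => ?_) (contDiffAt_pi.2 fun i => ?_) <;>
    fin_cases i
  · exact h1
  · simp; fun_prop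
  · simp; fun_prop
  · simp; fun_prop

/-- The range of the coordinates `(θ, z, p_θ, p_z)`. -/
def cylTarget (a : ℝ) : Set (SympSpace 2) :=
  {y | y.1 0 ∈ Ioo (-Real.pi) Real.pi ∧ |y.1 1| < a ∧ y.2 0 ^ 2 + y.2 1 ^ 2 < 1}

theorem cylParam_mem {a : ℝ} {w : ℂ} (hw : ‖w‖ = 1) {y : SympSpace 2} (h1 : |y.1 1| < a)
    (h2 : y.2 0 ^ 2 + y.2 1 ^ 2 < 1) : cylParam w y ∈ diskCotangentCylinder a := by
  have hw' : w.re ^ 2 + w.im ^ 2 = 1 := by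
    have := Complex.sq_norm w
    rw [hw, Complex.normSq_apply] at this
    nlinarith
  have hcs := Real.sin_sq_add_cos_sq (y.1 0)
  refine ⟨⟨?_, ?_⟩, ?_, ?_⟩
  · simp [cylParam]
    linear_combination (w.re ^ 2 + w.im ^ 2) * hcs + hw'
  · simpa [cylParam] using h1
  · simp [cylParam]; ring
  · simp [cylParam]
    have : (y.2 0 * (w.re * Real.sin (y.1 0) + w.im * Real.cos (y.1 0))) ^ 2 +
      (y.2 0 * (w.re * Real.cos (y.1 0) - w.im * Real.sin (y.1 0))) ^ 2 = y.2 0 ^ 2 := by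
      linear_combination (y.2 0) ^ 2 * (w.re ^ 2 + w.im ^ 2) * hcs + (y.2 0) ^ 2 * hw'
    linarith

theorem cylParam_mul_conj {w : ℂ} (hw : ‖w‖ = 1) (y : SympSpace 2) :
    (⟨(cylParam w y).1 0, (cylParam w y).1 1⟩ : ℂ) * (starRingEnd ℂ) w =
      Complex.exp ((y.1 0 : ℝ) * Complex.I) := by
  have hw' : w.re ^ 2 + w.im ^ 2 = 1 := by
    have := Complex.sq_norm w
    rw [hw, Complex.normSq_apply] at this
    nlinarith
  apply Complex.ext
  · simp [cylParam, Complex.exp_ofReal_mul_I_re]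
    linear_combination Real.cos (y.1 0) * hw'
  · simp [cylParam, Complex.exp_ofReal_mul_I_im]
    linear_combination Real.sin (y.1 0) * hw'

theorem cylCoord_cylParam {w : ℂ} (hw : ‖w‖ = 1) {y : SympSpace 2}
    (hy : y.1 0 ∈ Ioo (-Real.pi) Real.pi) : cylCoord w (cylParam w y) = y := by
  have hw' : w.re ^ 2 + w.im ^ 2 = 1 := by
    have := Complex.sq_norm w
    rw [hw, Complex.normSq_apply] at this
    nlinarith
  have hcs := Real.sin_sq_add_cos_sq (y.1 0)
  have harg : ((⟨(cylParam w y).1 0, (cylParam w y).1 1⟩ : ℂ) * (starRingEnd ℂ) w).arg = y.1 0 := by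
    rw [cylParam_mul_conj hw, Complex.exp_mul_I,
      Complex.arg_cos_add_sin_mul_I ⟨hy.1, hy.2.le⟩]
  unfold cylCoord
  rw [harg]
  refine Prod.ext (funext fun i => ?_) (funext fun i => ?_) <;> fin_cases i
  · rfl
  · simp [cylParam]
  · simp [cylParam]
    linear_combination (y.2 0) * (w.re ^ 2 + w.im ^ 2) * hcs + (y.2 0) * hw'
  · simp [cylParam]

theorem cylParam_cylCoord {a : ℝ} {w : ℂ} (hw : ‖w‖ = 1) {x : SympSpace 3}
    (hx : x ∈ diskCotangentCylinder a) : cylParam w (cylCoord w x) = x := by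
  obtain ⟨⟨h1, h2⟩, h3, h4⟩ := hx
  have hw' : w.re ^ 2 + w.im ^ 2 = 1 := by
    have := Complex.sq_norm w
    rw [hw, Complex.normSq_apply] at this
    nlinarith
  set u : ℂ := (⟨x.1 0, x.1 1⟩ : ℂ) * (starRingEnd ℂ) w with hu
  have hun : ‖u‖ = 1 := by
    have h5 : ‖(⟨x.1 0, x.1 1⟩ : ℂ)‖ = 1 := by
      rw [Complex.norm_def, Complex.normSq_apply, Real.sqrt_eq_one]
      simp; nlinarith
    rw [hu, norm_mul, Complex.norm_conj, h5, hw, one_mul]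
  have hu0 : u ≠ 0 := by
    intro h; rw [h] at hun; simp at hun
  have hc : Real.cos u.arg = x.1 0 * w.re + x.1 1 * w.im := by
    rw [Complex.cos_arg hu0, hun, hu]; simp
  have hs : Real.sin u.arg = x.1 1 * w.re - x.1 0 * w.im := by
    rw [Complex.sin_arg, hun, hu]; simp; ring
  have e0 : w.re * Real.cos u.arg - w.im * Real.sin u.arg = x.1 0 := by
    rw [hc, hs]; linear_combination x.1 0 * hw'
  have e1 : w.re * Real.sin u.arg + w.im * Real.cos u.arg = x.1 1 := by
    rw [hc, hs]; linear_combination x.1 1 * hw'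
  refine Prod.ext (funext fun i => ?_) (funext fun i => ?_) <;> fin_cases i
  · simpa [cylParam, cylCoord] using e0
  · simpa [cylParam, cylCoord] using e1
  · simp [cylParam, cylCoord]
  · simp only [cylParam, cylCoord, ← hu]
    simp [e0, e1]
    linear_combination x.2 0 * h1 - x.1 0 * h3
  · simp only [cylParam, cylCoord, ← hu]
    simp [e0, e1]
    linear_combination x.2 1 * h1 - x.1 1 * h3
  · simp [cylParam, cylCoord]

theorem cylCoord_mem {a : ℝ} {w : ℂ} {x : SympSpace 3} (hx : x ∈ diskCotangentCylinder a)
    (hs : (⟨x.1 0, x.1 1⟩ : ℂ) * (starRingEnd ℂ) w ∈ Complex.slitPlane) :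
    cylCoord w x ∈ cylTarget a := by
  obtain ⟨⟨h1, h2⟩, h3, h4⟩ := hx
  refine ⟨⟨?_, ?_⟩, ?_, ?_⟩
  · simpa [cylCoord] using Complex.neg_pi_lt_arg _
  · have := (Complex.mem_slitPlane_iff_arg.1 hs).1
    simpa [cylCoord] using lt_of_le_of_ne (Complex.arg_le_pi _) this
  · simpa [cylCoord] using h2
  · have : (x.1 0 * x.2 1 - x.1 1 * x.2 0) ^ 2 = x.2 0 ^ 2 + x.2 1 ^ 2 := by
      linear_combination (x.2 0 ^ 2 + x.2 1 ^ 2) * h1 - (x.1 0 * x.2 0 + x.1 1 * x.2 1) * h3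
    simp [cylCoord]
    linarith

/-- The direction `(q_1, q_2)` of the base point of `(q, p) ∈ D^*C_a`, as a unit complex number. -/
def cylBase {a : ℝ} (x₀ : diskCotangentCylinder a) : ℂ := ⟨x₀.1.1 0, x₀.1.1 1⟩

theorem norm_cylBase {a : ℝ} (x₀ : diskCotangentCylinder a) : ‖cylBase x₀‖ = 1 := by
  rw [Complex.norm_def, Complex.normSq_apply, Real.sqrt_eq_one]
  have := x₀.2.1.1
  simp only [cylBase]
  nlinarith

open Classical in
/-- The chart of `D^*C_a` by `(θ, z; p_θ, p_z)` around `x₀`, away from the opposite line `θ = π`. -/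
noncomputable def cylChart (a : ℝ) (x₀ : diskCotangentCylinder a) :
    OpenPartialHomeomorph (diskCotangentCylinder a) (SympSpace 2) where
  toFun x := cylCoord (cylBase x₀) x
  invFun y := if h : |y.1 1| < a ∧ y.2 0 ^ 2 + y.2 1 ^ 2 < 1 then
      ⟨cylParam (cylBase x₀) y, cylParam_mem (norm_cylBase x₀) h.1 h.2⟩ else x₀
  source := {x | (⟨x.1.1 0, x.1.1 1⟩ : ℂ) * (starRingEnd ℂ) (cylBase x₀) ∈ Complex.slitPlane}
  target := cylTarget a
  map_source' x hx := cylCoord_mem x.2 hx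
  map_target' y hy := by
    rw [dif_pos hy.2]
    show _ ∈ Complex.slitPlane
    rw [cylParam_mul_conj (norm_cylBase x₀), Complex.mem_slitPlane_iff_arg, Complex.exp_mul_I,
      Complex.arg_cos_add_sin_mul_I ⟨hy.1.1, hy.1.2.le⟩]
    refine ⟨hy.1.2.ne, ?_⟩
    rw [← Complex.exp_mul_I]
    exact Complex.exp_ne_zero _
  left_inv' x hx := by
    rw [dif_pos (cylCoord_mem x.2 hx).2]
    exact Subtype.ext (cylParam_cylCoord (norm_cylBase x₀) x.2)
  right_inv' y hy := by
    rw [dif_pos hy.2]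
    exact cylCoord_cylParam (norm_cylBase x₀) hy.1
  continuousOn_toFun := fun x hx =>
    ((contDiffAt_cylCoord _ hx).continuousAt.comp
      continuous_subtype_val.continuousAt).continuousWithinAt
  continuousOn_invFun := by
    rw [continuousOn_iff_continuous_domRestrict, Topology.IsInducing.subtypeVal.continuous_iff]
    refine ((contDiff_cylParam (cylBase x₀)).continuous.comp continuous_subtype_val).congr ?_
    intro y
    have := y.2.2
    simp [this]
  open_source := by
    refine Complex.isOpen_slitPlane.preimage (Continuous.mul ?_ continuous_const)
    refine Complex.equivRealProdCLM.symm.continuous.comp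
      (f := fun x : diskCotangentCylinder a => (x.1.1 0, x.1.1 1)) ?_
    fun_prop
  open_target := by
    refine IsOpen.inter (isOpen_Ioo.preimage (by fun_prop)) (IsOpen.inter ?_ ?_)
    · exact isOpen_lt (f := fun y : SympSpace 2 => |y.1 1|) (by fun_prop) continuous_const
    · exact isOpen_lt (f := fun y : SympSpace 2 => y.2 0 ^ 2 + y.2 1 ^ 2) (by fun_prop)
        continuous_const

theorem cylChart_symm_val {a : ℝ} (x₀ : diskCotangentCylinder a) {y : SympSpace 2}
    (hy : y ∈ cylTarget a) : ((cylChart a x₀).symm y : SympSpace 3) = cylParam (cylBase x₀) y := by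
  have h := hy.2
  show ((if h : |y.1 1| < a ∧ y.2 0 ^ 2 + y.2 1 ^ 2 < 1 then
      (⟨cylParam (cylBase x₀) y, cylParam_mem (norm_cylBase x₀) h.1 h.2⟩ :
        diskCotangentCylinder a) else x₀ : diskCotangentCylinder a) : SympSpace 3) = _
  rw [dif_pos h]

/-- The smooth structure of `D^*C_a` as a submanifold of `ℝ³ × ℝ³`. -/
noncomputable instance cylChartedSpace (a : ℝ) :
    ChartedSpace (SympSpace 2) (diskCotangentCylinder a) where
  atlas := range (cylChart a)
  chartAt := cylChart a
  mem_chart_source x := by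
    show cylBase x * (starRingEnd ℂ) (cylBase x) ∈ Complex.slitPlane
    rw [Complex.mul_conj, Complex.normSq_eq_norm_sq, norm_cylBase]
    simp
  chart_mem_atlas x := ⟨x, rfl⟩

instance cylIsManifold (a : ℝ) :
    IsManifold 𝓘(ℝ, SympSpace 2) ∞ (diskCotangentCylinder a) := by
  refine isManifold_of_contDiffOn _ _ _ ?_
  rintro _ _ ⟨x₀, rfl⟩ ⟨x₁, rfl⟩
  intro y hy
  have hy1 : y ∈ cylTarget a := hy.1.1
  have hy2 : (cylChart a x₀).symm y ∈ (cylChart a x₁).source := hy.1.2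
  have hy3 : (⟨(cylParam (cylBase x₀) y).1 0, (cylParam (cylBase x₀) y).1 1⟩ : ℂ) *
      (starRingEnd ℂ) (cylBase x₁) ∈ Complex.slitPlane := by
    rw [← cylChart_symm_val x₀ hy1]; exact hy2
  have h : ContDiffAt ℝ ∞ (cylCoord (cylBase x₁) ∘ cylParam (cylBase x₀)) y :=
    (contDiffAt_cylCoord _ hy3).comp y (contDiff_cylParam _).contDiffAt
  refine h.contDiffWithinAt.congr_of_eventuallyEq_of_mem ?_ hy
  filter_upwards [self_mem_nhdsWithin] with z hz
  have hz1 : z ∈ cylTarget a := hz.1.1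
  show cylCoord (cylBase x₁) ((cylChart a x₀).symm z : SympSpace 3) = _
  rw [cylChart_symm_val x₀ hz1]
  rfl

theorem contMDiff_cylInclusion (a : ℝ) : ContMDiff 𝓘(ℝ, SympSpace 2) 𝓘(ℝ, SympSpace 3) ∞
    (Subtype.val : diskCotangentCylinder a → SympSpace 3) := by
  rw [contMDiff_iff]
  refine ⟨continuous_subtype_val, fun x _ y hy => ?_⟩
  refine (contDiff_cylParam (cylBase x)).contDiffAt.contDiffWithinAt.congr_of_eventuallyEq_of_mem
    ?_ hy
  filter_upwards [self_mem_nhdsWithin] with z hz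
  have hz1 : z ∈ (cylChart a x).target := by
    have h := hz.1
    rw [extChartAt_target] at h
    exact h.1
  exact cylChart_symm_val x hz1

theorem stdForm_fderiv_cylParam {w : ℂ} (hw : ‖w‖ = 1) (y : SympSpace 2) :
    (stdForm 3).compContinuousLinearMap (fderiv ℝ (cylParam w) y) = stdForm 2 := by
  have hw' : w.re ^ 2 + w.im ^ 2 = 1 := by
    have := Complex.sq_norm w
    rw [hw, Complex.normSq_apply] at this
    nlinarith
  have hcs := Real.sin_sq_add_cos_sq (y.1 0)
  set S := w.re * Real.sin (y.1 0) + w.im * Real.cos (y.1 0) with hS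
  set C := w.re * Real.cos (y.1 0) - w.im * Real.sin (y.1 0) with hC
  have hSC : C ^ 2 + S ^ 2 = 1 := by
    rw [hS, hC]; linear_combination (w.re ^ 2 + w.im ^ 2) * hcs + hw'
  have key : ∀ v : SympSpace 2, fderiv ℝ (cylParam w) y v =
      (![-(S * v.1 0), C * v.1 0, v.1 1],
       ![-(v.2 0 * S + y.2 0 * (C * v.1 0)), v.2 0 * C - y.2 0 * (S * v.1 0), v.2 1]) := by
    intro v
    have hdiff : DifferentiableAt ℝ (cylParam w) y :=
      (contDiff_cylParam w).contDiffAt.differentiableAt (by simp)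
    -- differentiate along the line `t ↦ y + t v`
    have h1 : HasDerivAt (fun t : ℝ => cylParam w (y + t • v)) (fderiv ℝ (cylParam w) y v) 0 := by
      have hl : HasDerivAt (fun t : ℝ => y + t • v) v 0 := by
        simpa using ((hasDerivAt_id (0 : ℝ)).smul_const v).const_add y
      have : HasFDerivAt (cylParam w) (fderiv ℝ (cylParam w) y) (y + (0 : ℝ) • v) := by
        simpa using hdiff.hasFDerivAt
      exact this.comp_hasDerivAt 0 hl
    refine h1.unique ?_
    have hl : ∀ c d : ℝ, HasDerivAt (fun t : ℝ => c + t * d) d 0 := fun c d => by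
      simpa using ((hasDerivAt_id (0 : ℝ)).mul_const d).const_add c
    have hsin : HasDerivAt (fun t : ℝ => Real.sin (y.1 0 + t * v.1 0))
        (Real.cos (y.1 0) * v.1 0) 0 := by simpa using (hl (y.1 0) (v.1 0)).sin
    have hcos : HasDerivAt (fun t : ℝ => Real.cos (y.1 0 + t * v.1 0))
        (-Real.sin (y.1 0) * v.1 0) 0 := by simpa using (hl (y.1 0) (v.1 0)).cos
    have hCd : HasDerivAt (fun t : ℝ => w.re * Real.cos (y.1 0 + t * v.1 0) -
        w.im * Real.sin (y.1 0 + t * v.1 0)) (-(S * v.1 0)) 0 := by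
      convert! (hcos.const_mul w.re).sub (hsin.const_mul w.im) using 1
      rw [hS]; ring
    have hSd : HasDerivAt (fun t : ℝ => w.re * Real.sin (y.1 0 + t * v.1 0) +
        w.im * Real.cos (y.1 0 + t * v.1 0)) (C * v.1 0) 0 := by
      convert! (hsin.const_mul w.re).add (hcos.const_mul w.im) using 1
      rw [hC]; ring
    refine HasDerivAt.prodMk (hasDerivAt_pi.2 fun i => ?_) (hasDerivAt_pi.2 fun i => ?_) <;>
      fin_cases i
    · exact hCd
    · exact hSd
    · exact hl _ _
    · have := ((hl (y.2 0) (v.2 0)).mul hSd).neg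
      simp only [zero_mul, add_zero, ← hS] at this
      exact this
    · have := (hl (y.2 0) (v.2 0)).mul hCd
      simp only [zero_mul, add_zero, ← hC] at this
      convert! this using 1
      simp; ring
    · exact hl _ _
  ext v
  show stdForm 3 (fun i => fderiv ℝ (cylParam w) y (v i)) = _
  simp only [stdForm_apply, key, Fin.sum_univ_three, Fin.sum_univ_two]
  simp
  linear_combination ((v 0).2 0 * (v 1).1 0 - (v 0).1 0 * (v 1).2 0) * hSC

/-- `D^*C_a` as a symplectic manifold: the symplectic form is the restriction of `∑ dp_i ∧ dq_i`
to the submanifold `D^*C_a` of `T^*ℝ³`. -/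
noncomputable def diskCotangentBundle (a : ℝ) : SymplecticManifold 2 where
  carrier := diskCotangentCylinder a
  form := pullbackStdForm (Subtype.val : diskCotangentCylinder a → SympSpace 3)
  isSymplectic := by
    refine pullbackStdForm_isSymplectic (contMDiff_cylInclusion a) fun x v hv => ?_
    have hfd : fderiv ℝ ((Subtype.val : diskCotangentCylinder a → SympSpace 3) ∘
        (extChartAt 𝓘(ℝ, SympSpace 2) x).symm) (extChartAt 𝓘(ℝ, SympSpace 2) x x) =
        fderiv ℝ (cylParam (cylBase x)) (extChartAt 𝓘(ℝ, SympSpace 2) x x) := by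
      refine Filter.EventuallyEq.fderiv_eq ?_
      filter_upwards [(isOpen_extChartAt_target x).mem_nhds (mem_extChartAt_target x)] with z hz
      have hz1 : z ∈ (cylChart a x).target := by
        rw [extChartAt_target] at hz
        exact hz.1
      exact cylChart_symm_val x hz1
    rw [pullbackStdForm_apply_chart (contMDiff_cylInclusion a), hfd,
      stdForm_fderiv_cylParam (norm_cylBase x)] at hv
    exact stdForm_nondegenerate 2 v fun w => hv w

/-!
Upper bound: `D^*C_a` has Darboux coordinates `(θ, p_θ, z, p_z)`. Reading `p_θ + 1 ∈ (0, 2)` as an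
action, i.e. half a squared radius, and `θ` as an angle turns `(θ, p_θ)` into a point of the disk of
area `4π`, so `D^*C_a` embeds in the product of this disk and the rectangle `(-a, a) × (-1, 1)` of
area `4a`, hence in the cylinders over disks of both areas.

Lower bound: let `b = min a π`. As `|p_θ| + |p_z| < 1` implies `p_θ² + p_z² < 1`, the bundle
contains the product of the square `(-b, b)²` and the cross-polytope `{|p_θ| + |p_z| < 1}`; by a
rescaling of the positions it is enough to treat `b = π / 2`. The Pöschl–Teller potential
provides, for each `k > 0`, an area preserving embedding of the plane in `(-π / 2, π / 2) × ℝ`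
whose momentum at a point of action `I` is at most `I + k`. The product of two such maps sends the
ball of capacity `r`, where the sum of the actions is less than `r / 2π`, into the product of the
square and the cross-polytope as soon as `r / 2π + 2k ≤ 1`, which allows every `r < 2π`.
-/

section
variable {n : ℕ} {M : Type} [TopologicalSpace M] [ChartedSpace (SympSpace n) M]

theorem injective_fderiv_of_pullbackStdForm_nondegenerate {m : ℕ} {F : M → SympSpace m}
    (hF : ContMDiff 𝓘(ℝ, SympSpace n) 𝓘(ℝ, SympSpace m) ∞ F) {x : M}
    (hnd : ∀ v, (∀ w, pullbackStdForm (n := n) F x ![v, w] = 0) → v = 0) :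
    Function.Injective (fderiv ℝ (F ∘ (extChartAt 𝓘(ℝ, SympSpace n) x).symm)
      (extChartAt 𝓘(ℝ, SympSpace n) x x)) := by
  refine (injective_iff_map_eq_zero _).2 fun v hv => hnd v fun w => ?_
  rw [pullbackStdForm_apply_chart hF]
  refine (stdForm m).map_coord_zero (m := fun i => fderiv ℝ _ _ (![v, w] i)) 0 ?_
  exact hv

theorem isOpenMap_of_pullbackStdForm_nondegenerate [IsManifold 𝓘(ℝ, SympSpace n) ∞ M]
    {F : M → SympSpace n} (hF : ContMDiff 𝓘(ℝ, SympSpace n) 𝓘(ℝ, SympSpace n) ∞ F)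
    (hnd : ∀ (x : M) v, (∀ w, pullbackStdForm (n := n) F x ![v, w] = 0) → v = 0) :
    IsOpenMap F := by
  refine isOpenMap_iff_nhds_le.2 fun x => ?_
  have hstrict := (((contDiffOn_comp_extChartAt_symm hF x).contDiffAt
    ((isOpen_extChartAt_target x).mem_nhds (mem_extChartAt_target x))).hasStrictFDerivAt
      (by simp))
  have hsurj := LinearMap.range_eq_top.2 (LinearMap.injective_iff_surjective.1
    (injective_fderiv_of_pullbackStdForm_nondegenerate hF (hnd x)))
  have hchart : Filter.map (extChartAt 𝓘(ℝ, SympSpace n) x).symm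
      (𝓝 (extChartAt 𝓘(ℝ, SympSpace n) x x)) = 𝓝 x := by
    simpa using map_extChartAt_symm_nhdsWithin_range (I := 𝓘(ℝ, SympSpace n)) x
  have hmap := hstrict.map_nhds_eq_of_surj hsurj
  rw [← Filter.map_map, hchart, Function.comp_apply, extChartAt_to_inv] at hmap
  exact hmap.ge

theorem pullbackStdForm_comp {m : ℕ} {N : Type} [TopologicalSpace N]
    [ChartedSpace (SympSpace n) N] {φ : M → N} {F : N → SympSpace m}
    (hφ : ContMDiff 𝓘(ℝ, SympSpace n) 𝓘(ℝ, SympSpace n) ∞ φ)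
    (hF : ContMDiff 𝓘(ℝ, SympSpace n) 𝓘(ℝ, SympSpace m) ∞ F) (x : M) :
    (pullbackStdForm (n := n) F (φ x)).compContinuousLinearMap
      (mfderiv 𝓘(ℝ, SympSpace n) 𝓘(ℝ, SympSpace n) φ x) = pullbackStdForm (n := n) (F ∘ φ) x := by
  unfold pullbackStdForm
  rw [mfderiv_comp x (hF.mdifferentiable (by simp) _) (hφ.mdifferentiable (by simp) x)]
  rfl

end

section
variable {n m : ℕ} {M : SymplecticManifold n} {U V : TopologicalSpace.Opens (SympSpace n)}

theorem exists_isSymplecticEmbedding_ofOpen {F : M.carrier → SympSpace n}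
    (hF : ContMDiff 𝓘(ℝ, SympSpace n) 𝓘(ℝ, SympSpace n) ∞ F) (hinj : Function.Injective F)
    (hFV : ∀ x, F x ∈ V) (hform : ∀ x, pullbackStdForm (n := n) F x = M.form x) :
    ∃ φ, IsSymplecticEmbedding M (.ofOpen V) φ := by
  have hs : ContMDiff 𝓘(ℝ, SympSpace n) 𝓘(ℝ, SympSpace n) ∞ (fun x => (⟨F x, hFV x⟩ : V)) :=
    (ContMDiff.subtypeVal_comp_iff V _).1 hF
  have hopen : IsOpenMap F := isOpenMap_of_pullbackStdForm_nondegenerate hF fun x v hv =>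
    M.isSymplectic.nondegenerate x v fun w =>
      (congrArg (· ![v, w]) (hform x)).symm.trans (hv w)
  have hemb : IsEmbedding F :=
    (IsOpenEmbedding.of_continuous_injective_isOpenMap hF.continuous hinj hopen).isEmbedding
  refine ⟨fun x => (⟨F x, hFV x⟩ : V), hs,
    IsEmbedding.of_comp hs.continuous continuous_subtype_val hemb, fun x => ?_⟩
  exact (pullbackStdForm_comp (N := V) hs contMDiff_subtype_val x).trans (hform x)

theorem contMDiff_restrict {f : SympSpace n → SympSpace m} (hf : ∀ x ∈ U, ContDiffAt ℝ ∞ f x) :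
    ContMDiff 𝓘(ℝ, SympSpace n) 𝓘(ℝ, SympSpace m) ∞ (fun x : U => f x) := fun x =>
  ContMDiffAt.comp x (hf x x.2).contMDiffAt contMDiff_subtype_val.contMDiffAt

theorem pullbackStdForm_restrict {f : SympSpace n → SympSpace m}
    (hf : ∀ x ∈ U, ContDiffAt ℝ ∞ f x) (x : U) :
    pullbackStdForm (n := n) (fun x : U => f x) x =
      (stdForm m).compContinuousLinearMap (fderiv ℝ f x) := by
  rw [pullbackStdForm_apply_chart (contMDiff_restrict hf)]
  have hev : (fun x : U => f x) ∘ (extChartAt 𝓘(ℝ, SympSpace n) x).symm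
      =ᶠ[𝓝 (extChartAt 𝓘(ℝ, SympSpace n) x x)] f := by
    filter_upwards [(isOpen_extChartAt_target x).mem_nhds (mem_extChartAt_target x)] with z hz
    exact congrArg f ((extChartAt 𝓘(ℝ, SympSpace n) x).right_inv hz)
  rw [hev.fderiv_eq]
  rfl

theorem ofOpen_form (x : U) : (SymplecticManifold.ofOpen U).form x = stdForm n := by
  refine (pullbackStdForm_restrict (f := id) (fun _ _ => contDiffAt_id) x).trans ?_
  rw [fderiv_id]
  rfl

theorem exists_isSymplecticEmbedding_rescale_ofOpen {l : ℝ} (hl : l ≠ 0)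
    {f : SympSpace n → SympSpace n} (hf : ∀ x ∈ U, ContDiffAt ℝ ∞ f x) (hinj : InjOn f U)
    (hfV : MapsTo f U V)
    (hform : ∀ x ∈ U, (stdForm n).compContinuousLinearMap (fderiv ℝ f x) = l • stdForm n) :
    ∃ φ, IsSymplecticEmbedding ((SymplecticManifold.ofOpen U).rescale l hl) (.ofOpen V) φ := by
  refine exists_isSymplecticEmbedding_ofOpen (M := (SymplecticManifold.ofOpen U).rescale l hl)
    (F := fun x : U => f x) (contMDiff_restrict hf) (injOn_iff_injective.1 hinj)
    (fun x : U => hfV x.2) fun x : U => ?_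
  exact ((pullbackStdForm_restrict hf x).trans (hform x x.2)).trans
    (congrArg (l • ·) (ofOpen_form x).symm)

theorem exists_isSymplecticEmbedding_of_inChart_eq_stdForm {x₀ : M.carrier}
    (hU : (U : Set (SympSpace n)) ⊆ (chartAt (SympSpace n) x₀).target)
    (hform : ∀ y ∈ U, inChart M.form x₀ y = stdForm n) :
    ∃ φ, IsSymplecticEmbedding (.ofOpen U) M φ := by
  have hsymm := contMDiffOn_extChartAt_symm (I := 𝓘(ℝ, SympSpace n)) (n := ∞) x₀
  have htarget : ∀ y : U, (y : SympSpace n) ∈ (extChartAt 𝓘(ℝ, SympSpace n) x₀).target :=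
    fun y => by simpa using hU y.2
  refine ⟨fun y : U => (extChartAt 𝓘(ℝ, SympSpace n) x₀).symm y,
    hsymm.comp_contMDiff contMDiff_subtype_val htarget, ?_, fun y : U => ?_⟩
  · exact (chartAt (SympSpace n) x₀).symm.isOpenEmbedding_restrict.isEmbedding.comp
      (IsEmbedding.inclusion hU)
  · have hval := (contMDiff_subtype_val (I := 𝓘(ℝ, SympSpace n)) (n := ∞) (U := U)).mdifferentiable
      (by simp) y
    have hy := ((hsymm y (htarget y)).contMDiffAt ((isOpen_extChartAt_target x₀).mem_nhds
      (htarget y))).mdifferentiableAt (by simp)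
    refine Eq.trans ?_ (congrArg (ContinuousAlternatingMap.compContinuousLinearMap ·
      (mfderiv 𝓘(ℝ, SympSpace n) 𝓘(ℝ, SympSpace n) (Subtype.val : U → SympSpace n) y))
      (hform y y.2))
    exact congrArg ((M.form _).compContinuousLinearMap ·) (mfderiv_comp (M := U) y hy hval)

variable [NeZero n] {c : SymplecticManifold n → ℝ≥0∞}

theorem IsSymplecticCapacity.mono_ofOpen (hc : IsSymplecticCapacity n c) (hUV : U ≤ V) :
    c (.ofOpen U) ≤ c (.ofOpen V) :=
  hc.monotone _ _ (exists_isSymplecticEmbedding_ofOpen (M := .ofOpen U)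
    (F := fun x : U => (x : SympSpace n)) contMDiff_subtype_val Subtype.val_injective
    (fun x : U => hUV x.2) fun _ => rfl)
end

section
variable {E : Type*} [NormedAddCommGroup E] [NormedSpace ℝ E] {f g : E → E} {l l' : ℝ} {z : E}

/-- `f` is smooth at `z` with Jacobian determinant `l`. For maps of the plane, this says that `f`
multiplies the area form by `l` at `z`. -/
structure HasJacobianAt (f : E → E) (l : ℝ) (z : E) : Prop where
  contDiffAt : ContDiffAt ℝ ∞ f z
  det_fderiv : (fderiv ℝ f z).det = l

theorem HasJacobianAt.differentiableAt (h : HasJacobianAt f l z) : DifferentiableAt ℝ f z :=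
  h.contDiffAt.differentiableAt (by simp)

theorem hasJacobianAt_id (z : E) : HasJacobianAt id 1 z :=
  ⟨contDiffAt_id, by rw [fderiv_id]; exact LinearMap.det_id⟩

theorem HasJacobianAt.comp (hg : HasJacobianAt g l' (f z)) (hf : HasJacobianAt f l z) :
    HasJacobianAt (g ∘ f) (l' * l) z := by
  refine ⟨hg.contDiffAt.comp z hf.contDiffAt, ?_⟩
  rw [fderiv_comp z hg.differentiableAt hf.differentiableAt, ← hg.det_fderiv, ← hf.det_fderiv]
  exact LinearMap.det_comp _ _

end

theorem det_prod_self {R : Type*} [CommRing R] (A : R × R →ₗ[R] R × R) :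
    LinearMap.det A = (A (1, 0)).1 * (A (0, 1)).2 - (A (0, 1)).1 * (A (1, 0)).2 := by
  rw [← LinearMap.det_toMatrix (Module.Basis.finTwoProd R), Matrix.det_fin_two]
  simp [LinearMap.toMatrix_apply]

theorem apply_prod_eq_smul_add_smul {R : Type*} [CommRing R] (A : R × R →ₗ[R] R × R) (v : R × R) :
    A v = v.1 • A (1, 0) + v.2 • A (0, 1) := by
  rw [← map_smul, ← map_smul, ← map_add]
  simp

theorem areaForm_map {R : Type*} [CommRing R] (A : R × R →ₗ[R] R × R) (v w : R × R) :
    (A v).2 * (A w).1 - (A v).1 * (A w).2 = LinearMap.det A * (v.2 * w.1 - v.1 * w.2) := by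
  rw [det_prod_self, apply_prod_eq_smul_add_smul A v, apply_prod_eq_smul_add_smul A w]
  simp only [Prod.fst_add, Prod.snd_add, Prod.smul_fst, Prod.smul_snd, smul_eq_mul]
  ring

theorem hasJacobianAt_of_hasDerivAt {f : ℝ × ℝ → ℝ × ℝ} {l : ℝ} {z d₁ d₂ : ℝ × ℝ}
    (hf : ContDiffAt ℝ ∞ f z) (h₁ : HasDerivAt (fun t => f (t, z.2)) d₁ z.1)
    (h₂ : HasDerivAt (fun t => f (z.1, t)) d₂ z.2) (hdet : d₁.1 * d₂.2 - d₂.1 * d₁.2 = l) :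
    HasJacobianAt f l z := by
  refine ⟨hf, ?_⟩
  have hd : HasFDerivAt f (fderiv ℝ f z) z := (hf.differentiableAt (by simp)).hasFDerivAt
  have e₁ : fderiv ℝ f z (1, 0) = d₁ := (HasFDerivAt.comp_hasDerivAt z.1 hd
    ((hasDerivAt_id z.1).prodMk (hasDerivAt_const _ _))).unique h₁
  have e₂ : fderiv ℝ f z (0, 1) = d₂ := (HasFDerivAt.comp_hasDerivAt z.2 hd
    ((hasDerivAt_const _ _).prodMk (hasDerivAt_id z.2))).unique h₂
  rw [← hdet, ← e₁, ← e₂]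
  exact det_prod_self (fderiv ℝ f z : ℝ × ℝ →ₗ[ℝ] ℝ × ℝ)

/-- The plane map `(x, y) ↦ (b x + s, c y + t)`. -/
def diagAffine (b s c t : ℝ) (z : ℝ × ℝ) : ℝ × ℝ := (b * z.1 + s, c * z.2 + t)

theorem hasJacobianAt_diagAffine (b s c t : ℝ) (z : ℝ × ℝ) :
    HasJacobianAt (diagAffine b s c t) (b * c) z := by
  refine hasJacobianAt_of_hasDerivAt (d₁ := (b, 0)) (d₂ := (0, c))
    (ContDiff.contDiffAt (by unfold diagAffine; fun_prop))
    (HasDerivAt.prodMk ?_ (hasDerivAt_const z.1 (c * z.2 + t)))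
    (HasDerivAt.prodMk (hasDerivAt_const z.2 (b * z.1 + s)) ?_)
    (by simp)
  · simpa using ((hasDerivAt_id z.1).const_mul b).add_const s
  · simpa using ((hasDerivAt_id z.2).const_mul c).add_const t

theorem injective_diagAffine {b c : ℝ} (hb : b ≠ 0) (hc : c ≠ 0) (s t : ℝ) :
    Function.Injective (diagAffine b s c t) := by
  rintro ⟨x, y⟩ ⟨x', y'⟩ h
  simpa [diagAffine, hb, hc] using h

/-- The plane point with action `z.2`, that is half its squared radius, and angle `z.1`, measured
clockwise from the second axis so that the map preserves `dy ∧ dx`. -/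
noncomputable def actionAngle (z : ℝ × ℝ) : ℝ × ℝ :=
  (√(2 * z.2) * Real.sin z.1, √(2 * z.2) * Real.cos z.1)

theorem hasJacobianAt_actionAngle {z : ℝ × ℝ} (hz : 0 < z.2) : HasJacobianAt actionAngle 1 z := by
  have hpos : 0 < 2 * z.2 := by linarith
  have hR : √(2 * z.2) ≠ 0 := (Real.sqrt_pos.2 hpos).ne'
  have hsqrt : ContDiffAt ℝ ∞ (fun z : ℝ × ℝ => √(2 * z.2)) z :=
    ContDiffAt.sqrt (ContDiff.contDiffAt (by fun_prop)) hpos.ne'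
  have hr : HasDerivAt (fun t : ℝ => √(2 * t)) (1 / √(2 * z.2)) z.2 := by
    convert! (hasDerivAt_const_mul (2 : ℝ)).sqrt hpos.ne' using 1
    field_simp
  refine hasJacobianAt_of_hasDerivAt
    (d₁ := (√(2 * z.2) * Real.cos z.1, √(2 * z.2) * -Real.sin z.1))
    (d₂ := (1 / √(2 * z.2) * Real.sin z.1, 1 / √(2 * z.2) * Real.cos z.1))
    ((hsqrt.mul (by fun_prop)).prodMk (hsqrt.mul (by fun_prop)))
    (((Real.hasDerivAt_sin z.1).const_mul √(2 * z.2)).prodMk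
      ((Real.hasDerivAt_cos z.1).const_mul √(2 * z.2)))
    ((hr.mul_const (Real.sin z.1)).prodMk (hr.mul_const (Real.cos z.1))) ?_
  field_simp
  linear_combination Real.sin_sq_add_cos_sq z.1

theorem sq_add_sq_actionAngle {z : ℝ × ℝ} (hz : 0 ≤ z.2) :
    (actionAngle z).1 ^ 2 + (actionAngle z).2 ^ 2 = 2 * z.2 := by
  have hsq : √(2 * z.2) ^ 2 = 2 * z.2 := Real.sq_sqrt (by linarith)
  simp only [actionAngle]
  linear_combination hsq + √(2 * z.2) ^ 2 * Real.sin_sq_add_cos_sq z.1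

theorem injOn_actionAngle : InjOn actionAngle (Ioo (-Real.pi) Real.pi ×ˢ Ioi 0) := by
  rintro ⟨θ, I⟩ ⟨hθ : θ ∈ Ioo _ _, hI : 0 < I⟩ ⟨θ', I'⟩ ⟨hθ' : θ' ∈ Ioo _ _, hI' : 0 < I'⟩ h
  obtain rfl : I = I' := by
    have := sq_add_sq_actionAngle (z := (θ, I)) hI.le
    rw [h, sq_add_sq_actionAngle (z := (θ', I')) hI'.le] at this
    linarith
  have hR : √(2 * I) ≠ 0 := (Real.sqrt_pos.2 (by linarith)).ne'
  obtain ⟨hsin, hcos⟩ : Real.sin θ = Real.sin θ' ∧ Real.cos θ = Real.cos θ' := by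
    simpa only [actionAngle, Prod.mk.injEq, mul_right_inj' hR] using h
  have hangle : (θ : Real.Angle) = θ' := Real.Angle.cos_sin_inj hcos hsin
  rw [← Real.Angle.toReal_coe_eq_self_iff.2 (Ioo_subset_Ioc_self hθ), hangle,
    Real.Angle.toReal_coe_eq_self_iff.2 (Ioo_subset_Ioc_self hθ')]

/-- The plane map `(S, T) ↦ (q, p)` with `S = sin q` and `T = p cos q`. -/
noncomputable def arcsinLift (z : ℝ × ℝ) : ℝ × ℝ := (Real.arcsin z.1, z.2 / √(1 - z.1 ^ 2))

theorem hasJacobianAt_arcsinLift {z : ℝ × ℝ} (hz : 0 < 1 - z.1 ^ 2) :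
    HasJacobianAt arcsinLift (1 - z.1 ^ 2)⁻¹ z := by
  have hne : z.1 ≠ -1 ∧ z.1 ≠ 1 := ⟨by nlinarith, by nlinarith⟩
  have hR : √(1 - z.1 ^ 2) ≠ 0 := (Real.sqrt_pos.2 hz).ne'
  have hsqrt : HasDerivAt (fun t : ℝ => √(1 - t ^ 2)) (-(2 * z.1) / (2 * √(1 - z.1 ^ 2))) z.1 := by
    simpa using ((hasDerivAt_pow 2 z.1).const_sub 1).sqrt hz.ne'
  have hsmooth : ContDiffAt ℝ ∞ arcsinLift z :=
    ((Real.contDiffAt_arcsin hne.1 hne.2).comp z contDiffAt_fst).prodMk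
      (contDiffAt_snd.div (ContDiffAt.sqrt (by fun_prop) hz.ne') hR)
  refine hasJacobianAt_of_hasDerivAt hsmooth
    ((Real.hasDerivAt_arcsin hne.1 hne.2).prodMk ((hasDerivAt_const z.1 z.2).div hsqrt hR))
    ((hasDerivAt_const z.2 (Real.arcsin z.1)).prodMk
      ((hasDerivAt_id z.2).div_const √(1 - z.1 ^ 2))) ?_
  simp only [zero_mul, sub_zero]
  rw [one_div_mul_one_div, Real.mul_self_sqrt hz.le, one_div]

theorem injOn_arcsinLift : InjOn arcsinLift {z | 0 < 1 - z.1 ^ 2} := by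
  rintro ⟨S, T⟩ (hS : 0 < 1 - S ^ 2) ⟨S', T'⟩ (hS' : 0 < 1 - S' ^ 2) h
  have hR : √(1 - S ^ 2) ≠ 0 := (Real.sqrt_pos.2 hS).ne'
  obtain ⟨hq : Real.arcsin S = Real.arcsin S', hp : T / √(1 - S ^ 2) = T' / √(1 - S' ^ 2)⟩ :=
    Prod.mk.inj h
  obtain rfl : S = S' := Real.injOn_arcsin (by constructor <;> nlinarith)
    (by constructor <;> nlinarith) hq
  rw [(div_left_inj' hR).1 hp]

/-- For `I = (x² + y²) / 2`, the map sending the circle of action `I` to the ellipse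
`(I + k)² S² + T² = (I + k)² - k²`. -/
noncomputable def circleToEllipse (k : ℝ) (z : ℝ × ℝ) : ℝ × ℝ :=
  (z.1 * √(((z.1 ^ 2 + z.2 ^ 2) / 2 + 2 * k) / 2) / ((z.1 ^ 2 + z.2 ^ 2) / 2 + k),
    z.2 * √(((z.1 ^ 2 + z.2 ^ 2) / 2 + 2 * k) / 2))

section
variable {k : ℝ} (hk : 0 < k) (z : ℝ × ℝ)
include hk

theorem sq_circleToEllipse :
    ((z.1 ^ 2 + z.2 ^ 2) / 2 + k) ^ 2 * (1 - (circleToEllipse k z).1 ^ 2) =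
      k ^ 2 + (circleToEllipse k z).2 ^ 2 := by
  have hm : √(((z.1 ^ 2 + z.2 ^ 2) / 2 + 2 * k) / 2) ^ 2 = ((z.1 ^ 2 + z.2 ^ 2) / 2 + 2 * k) / 2 :=
    Real.sq_sqrt (by positivity)
  simp only [circleToEllipse, div_pow, mul_pow, hm]
  field_simp
  ring

theorem one_sub_sq_circleToEllipse_pos : 0 < 1 - (circleToEllipse k z).1 ^ 2 :=
  pos_of_mul_pos_right (sq_circleToEllipse hk z ▸ by positivity)
    (sq_nonneg ((z.1 ^ 2 + z.2 ^ 2) / 2 + k))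

theorem hasJacobianAt_circleToEllipse :
    HasJacobianAt (circleToEllipse k) (1 - (circleToEllipse k z).1 ^ 2) z := by
  have hm0 : 0 < ((z.1 ^ 2 + z.2 ^ 2) / 2 + 2 * k) / 2 := by positivity
  have hn0 : 0 < (z.1 ^ 2 + z.2 ^ 2) / 2 + k := by positivity
  have hm := Real.sqrt_pos.2 hm0
  have hmsq := Real.sq_sqrt hm0.le
  have hsm : ContDiffAt ℝ ∞ (fun z : ℝ × ℝ => √(((z.1 ^ 2 + z.2 ^ 2) / 2 + 2 * k) / 2)) z :=
    ContDiffAt.sqrt (by fun_prop) hm0.ne'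
  have hsmooth : ContDiffAt ℝ ∞ (circleToEllipse k) z :=
    ((contDiffAt_fst.mul hsm).div (by fun_prop) hn0.ne').prodMk (contDiffAt_snd.mul hsm)
  have hI₁ : HasDerivAt (fun t => (t ^ 2 + z.2 ^ 2) / 2) z.1 z.1 := by
    simpa using ((hasDerivAt_pow 2 z.1).add_const (z.2 ^ 2)).div_const 2
  have hI₂ : HasDerivAt (fun t => (z.1 ^ 2 + t ^ 2) / 2) z.2 z.2 := by
    simpa using ((hasDerivAt_pow 2 z.2).const_add (z.1 ^ 2)).div_const 2
  have hm₁ := ((hI₁.add_const (2 * k)).div_const 2).sqrt hm0.ne'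
  have hm₂ := ((hI₂.add_const (2 * k)).div_const 2).sqrt hm0.ne'
  refine hasJacobianAt_of_hasDerivAt hsmooth
    ((((hasDerivAt_id z.1).mul hm₁).div (hI₁.add_const k) hn0.ne').prodMk (hm₁.const_mul z.2))
    (((hm₂.const_mul z.1).div (hI₂.add_const k) hn0.ne').prodMk ((hasDerivAt_id z.2).mul hm₂)) ?_
  simp only [Pi.mul_apply, id, circleToEllipse]
  generalize √(((z.1 ^ 2 + z.2 ^ 2) / 2 + 2 * k) / 2) = m at *
  have hn : (z.1 ^ 2 + z.2 ^ 2) / 2 + k = m ^ 2 + (z.1 ^ 2 + z.2 ^ 2) / 4 := by rw [hmsq]; ring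
  rw [hn] at hn0 ⊢
  field_simp
  ring

omit z in
theorem injective_circleToEllipse : Function.Injective (circleToEllipse k) := by
  intro z z' h
  have hS := one_sub_sq_circleToEllipse_pos hk z
  have hI := sq_circleToEllipse hk z
  rw [h] at hS hI
  have hsq := mul_right_cancel₀ hS.ne' (hI.trans (sq_circleToEllipse hk z').symm)
  have hII' : (z.1 ^ 2 + z.2 ^ 2) / 2 = (z'.1 ^ 2 + z'.2 ^ 2) / 2 :=
    add_right_cancel ((sq_eq_sq₀ (by positivity) (by positivity)).1 hsq)
  have hm : √(((z'.1 ^ 2 + z'.2 ^ 2) / 2 + 2 * k) / 2) ≠ 0 := by positivity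
  have hn : (z'.1 ^ 2 + z'.2 ^ 2) / 2 + k ≠ 0 := by positivity
  obtain ⟨h₁, h₂⟩ := Prod.ext_iff.1 h
  simp only [circleToEllipse, hII', div_left_inj' hn, mul_left_inj' hm] at h₁ h₂
  exact Prod.ext h₁ h₂

end

/-- The Pöschl–Teller Hamiltonian on `(-π/2, π/2) × ℝ`, `√(p² + k² / cos² q)`, has `I + k` as its
expression in action-angle coordinates. This symplectomorphism of the plane onto the strip sends
the circle of action `I` to the corresponding energy level. -/
noncomputable def poschlTellerMap (k : ℝ) : ℝ × ℝ → ℝ × ℝ := arcsinLift ∘ circleToEllipse k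

section
variable {k : ℝ} (hk : 0 < k)
include hk

theorem hasJacobianAt_poschlTellerMap (z : ℝ × ℝ) : HasJacobianAt (poschlTellerMap k) 1 z := by
  have hS := one_sub_sq_circleToEllipse_pos hk z
  rw [← inv_mul_cancel₀ hS.ne']
  exact (hasJacobianAt_arcsinLift hS).comp (hasJacobianAt_circleToEllipse hk z)

theorem injective_poschlTellerMap : Function.Injective (poschlTellerMap k) := fun z z' h =>
  injective_circleToEllipse hk (injOn_arcsinLift (one_sub_sq_circleToEllipse_pos hk z)
    (one_sub_sq_circleToEllipse_pos hk z') h)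

theorem abs_fst_poschlTellerMap_lt (z : ℝ × ℝ) : |(poschlTellerMap k z).1| < Real.pi / 2 := by
  have hS := one_sub_sq_circleToEllipse_pos hk z
  exact abs_lt.2 ⟨Real.neg_pi_div_two_lt_arcsin.2 (by nlinarith),
    Real.arcsin_lt_pi_div_two.2 (by nlinarith)⟩

theorem abs_snd_poschlTellerMap_le (z : ℝ × ℝ) :
    |(poschlTellerMap k z).2| ≤ (z.1 ^ 2 + z.2 ^ 2) / 2 + k := by
  have hS := one_sub_sq_circleToEllipse_pos hk z
  refine abs_le_of_sq_le_sq ?_ (by positivity)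
  simp only [poschlTellerMap, arcsinLift, Function.comp_apply, div_pow, Real.sq_sqrt hS.le]
  rw [div_le_iff₀ hS, sq_circleToEllipse hk]
  exact le_add_of_nonneg_left (sq_nonneg k)

end

/-- The product of the plane maps `f i`, the `i`-th of them applied to the coordinates of index
`e i`. -/
def planeProd {n : ℕ} (e : Equiv.Perm (Fin n)) (f : Fin n → ℝ × ℝ → ℝ × ℝ) (y : SympSpace n) :
    SympSpace n :=
  (fun i => (f i (y.1 (e i), y.2 (e i))).1, fun i => (f i (y.1 (e i), y.2 (e i))).2)

section
variable {n : ℕ} {e : Equiv.Perm (Fin n)} {f : Fin n → ℝ × ℝ → ℝ × ℝ}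

theorem hasFDerivAt_planeProd {f' : Fin n → ℝ × ℝ →L[ℝ] ℝ × ℝ} {y : SympSpace n}
    (h : ∀ i, HasFDerivAt (f i) (f' i) (y.1 (e i), y.2 (e i))) :
    ∃ F' : SympSpace n →L[ℝ] SympSpace n, HasFDerivAt (planeProd e f) F' y ∧
      ⇑F' = planeProd e fun i => f' i := by
  let coords (j : Fin n) : SympSpace n →L[ℝ] ℝ × ℝ :=
    ((ContinuousLinearMap.proj j).comp (ContinuousLinearMap.fst ℝ _ _)).prod
      ((ContinuousLinearMap.proj j).comp (ContinuousLinearMap.snd ℝ _ _))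
  have hfactor (i : Fin n) : HasFDerivAt (fun y : SympSpace n => f i (y.1 (e i), y.2 (e i)))
      ((f' i).comp (coords (e i))) y :=
    HasFDerivAt.comp y (h i) (coords (e i)).hasFDerivAt
  exact ⟨_, (hasFDerivAt_pi.2 fun i => (hfactor i).fst).prodMk
    (hasFDerivAt_pi.2 fun i => (hfactor i).snd), rfl⟩

theorem contDiffAt_planeProd {y : SympSpace n}
    (h : ∀ i, ContDiffAt ℝ ∞ (f i) (y.1 (e i), y.2 (e i))) : ContDiffAt ℝ ∞ (planeProd e f) y := by
  have hfactor (i : Fin n) :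
      ContDiffAt ℝ ∞ (fun y : SympSpace n => f i (y.1 (e i), y.2 (e i))) y :=
    ContDiffAt.comp y (h i) (ContDiff.contDiffAt (by fun_prop))
  exact (contDiffAt_pi.2 fun i => (hfactor i).fst).prodMk
    (contDiffAt_pi.2 fun i => (hfactor i).snd)

theorem stdForm_fderiv_planeProd {l : ℝ} {y : SympSpace n}
    (h : ∀ i, HasJacobianAt (f i) l (y.1 (e i), y.2 (e i))) :
    (stdForm n).compContinuousLinearMap (fderiv ℝ (planeProd e f) y) = l • stdForm n := by
  obtain ⟨F', hF', hF'_apply⟩ :=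
    hasFDerivAt_planeProd fun i => (h i).differentiableAt.hasFDerivAt
  rw [hF'.fderiv]
  ext v
  change stdForm n (fun i => F' (v i)) = l * stdForm n v
  simp only [stdForm_apply, hF'_apply, planeProd, Finset.mul_sum]
  refine (Finset.sum_congr rfl fun i _ => ?_).trans
    (Equiv.sum_comp e fun j => l * ((v 0).2 j * (v 1).1 j - (v 0).1 j * (v 1).2 j))
  rw [← (h i).det_fderiv]
  exact areaForm_map _ ((v 0).1 (e i), (v 0).2 (e i)) ((v 1).1 (e i), (v 1).2 (e i))

theorem injOn_planeProd {s : Fin n → Set (ℝ × ℝ)} (h : ∀ i, InjOn (f i) (s i)) :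
    InjOn (planeProd e f) {y | ∀ i, (y.1 (e i), y.2 (e i)) ∈ s i} := by
  intro y hy y' hy' heq
  have hcoords (j : Fin n) : (y.1 j, y.2 j) = (y'.1 j, y'.2 j) := by
    obtain ⟨i, rfl⟩ := e.surjective j
    exact h i (hy i) (hy' i)
      (Prod.ext (congrFun (congrArg Prod.fst heq) i) (congrFun (congrArg Prod.snd heq) i))
  exact Prod.ext (funext fun j => congrArg Prod.fst (hcoords j))
    (funext fun j => congrArg Prod.snd (hcoords j))

theorem injective_planeProd (h : ∀ i, Function.Injective (f i)) :
    Function.Injective (planeProd e f) := fun _ _ =>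
  injOn_planeProd (s := fun _ => univ) (fun i => (h i).injOn) (fun _ => trivial) fun _ => trivial

variable [NeZero n] {c : SymplecticManifold n → ℝ≥0∞} {U V : TopologicalSpace.Opens (SympSpace n)}

theorem IsSymplecticCapacity.ofReal_abs_mul_le_of_planeProd (hc : IsSymplecticCapacity n c)
    {l : ℝ} (hl : l ≠ 0) (hf : ∀ y ∈ U, ∀ i, HasJacobianAt (f i) l (y.1 (e i), y.2 (e i)))
    (hinj : InjOn (planeProd e f) U) (hUV : MapsTo (planeProd e f) U V) :
    ENNReal.ofReal |l| * c (.ofOpen U) ≤ c (.ofOpen V) :=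
  hc.conformal (.ofOpen U) l hl ▸ hc.monotone _ _
    (exists_isSymplecticEmbedding_rescale_ofOpen hl
      (fun y hy => contDiffAt_planeProd fun i => (hf y hy i).contDiffAt) hinj hUV
      fun y hy => stdForm_fderiv_planeProd (hf y hy))

theorem IsSymplecticCapacity.le_of_planeProd (hc : IsSymplecticCapacity n c)
    (hf : ∀ y ∈ U, ∀ i, HasJacobianAt (f i) 1 (y.1 (e i), y.2 (e i)))
    (hinj : InjOn (planeProd e f) U) (hUV : MapsTo (planeProd e f) U V) :
    c (.ofOpen U) ≤ c (.ofOpen V) := by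
  simpa using hc.ofReal_abs_mul_le_of_planeProd one_ne_zero hf hinj hUV

end

/-- The cylinder `{x_i² + y_i² < r / π}` over a disk in the `i`-th coordinate plane. -/
def coordCylinder {n : ℕ} (i : Fin n) (r : ℝ) : TopologicalSpace.Opens (SympSpace n) :=
  ⟨{v | v.1 i ^ 2 + v.2 i ^ 2 < r / Real.pi}, isOpen_lt (by fun_prop) continuous_const⟩

section
variable {n : ℕ} [NeZero n] {c : SymplecticManifold n → ℝ≥0∞}

theorem IsNormalizedSymplecticCapacity.ofReal_le_sympBall
    (hc : IsNormalizedSymplecticCapacity n c) {r : ℝ} (hr : 0 < r) :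
    ENNReal.ofReal r ≤ c (sympBall n r) := by
  have hs : √r ≠ 0 := (Real.sqrt_pos.2 hr).ne'
  have hl : √r * √r = r := Real.mul_self_sqrt hr.le
  have hmaps (x : SympSpace n) (hx : ∑ i, x.1 i ^ 2 + ∑ i, x.2 i ^ 2 < 1 / Real.pi) :
      ∑ i, (√r * x.1 i + 0) ^ 2 + ∑ i, (√r * x.2 i + 0) ^ 2 < r / Real.pi := by
    simp only [add_zero, mul_pow, Real.sq_sqrt hr.le, ← Finset.mul_sum, ← mul_add]
    rw [div_eq_mul_one_div]
    exact mul_lt_mul_of_pos_left hx hr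
  have h : ENNReal.ofReal |√r * √r| * c (sympBall n 1) ≤ c (sympBall n r) :=
    hc.ofReal_abs_mul_le_of_planeProd (e := 1) (mul_ne_zero hs hs)
      (fun _ _ _ => hasJacobianAt_diagAffine √r 0 √r 0 _)
      (injective_planeProd fun _ => injective_diagAffine hs hs 0 0).injOn hmaps
  rwa [hl, abs_of_pos hr, hc.ball_eq_one, mul_one] at h

theorem IsNormalizedSymplecticCapacity.coordCylinder_le
    (hc : IsNormalizedSymplecticCapacity n c) (i : Fin n) {r : ℝ} (hr : 0 < r) :
    c (.ofOpen (coordCylinder i r)) ≤ ENNReal.ofReal r := by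
  have hs : (√r)⁻¹ ≠ 0 := inv_ne_zero (Real.sqrt_pos.2 hr).ne'
  have hl : (√r)⁻¹ * (√r)⁻¹ = r⁻¹ := by rw [← mul_inv, Real.mul_self_sqrt hr.le]
  have hmaps (x : SympSpace n) (hx : x.1 i ^ 2 + x.2 i ^ 2 < r / Real.pi) :
      ((√r)⁻¹ * x.1 (Equiv.swap 0 i 0) + 0) ^ 2 + ((√r)⁻¹ * x.2 (Equiv.swap 0 i 0) + 0) ^ 2 <
        1 / Real.pi := by
    simp only [Equiv.swap_apply_left, add_zero, mul_pow, inv_pow, Real.sq_sqrt hr.le, ← mul_add]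
    rwa [inv_mul_lt_iff₀ hr, mul_one_div]
  have h : ENNReal.ofReal |(√r)⁻¹ * (√r)⁻¹| * c (.ofOpen (coordCylinder i r)) ≤
      c (sympCylinder n 1) :=
    hc.ofReal_abs_mul_le_of_planeProd (e := Equiv.swap 0 i) (mul_ne_zero hs hs)
      (fun _ _ _ => hasJacobianAt_diagAffine (√r)⁻¹ 0 (√r)⁻¹ 0 _)
      (injective_planeProd fun _ => injective_diagAffine hs hs 0 0).injOn hmaps
  rwa [hl, abs_of_pos (inv_pos.2 hr), hc.cylinder_eq_one, ENNReal.ofReal_inv_of_pos hr,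
    ENNReal.inv_mul_le_iff (ENNReal.ofReal_pos.2 hr).ne' ENNReal.ofReal_ne_top, mul_one] at h

end

/-- The product `{|x_i| < a for all i, ∑ |y_i| < 1}` of a cube and a cross-polytope. -/
def cubeProdCrossPolytope (n : ℕ) (a : ℝ) : TopologicalSpace.Opens (SympSpace n) :=
  ⟨{y | (∀ i, |y.1 i| < a) ∧ ∑ i, |y.2 i| < 1}, by
    simp only [ofPred_and, ofPred_forall]
    exact (isOpen_iInter_of_finite fun i => isOpen_lt (by fun_prop) continuous_const).inter
      (isOpen_lt (by fun_prop) continuous_const)⟩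

section
variable {n : ℕ} [NeZero n] {c : SymplecticManifold n → ℝ≥0∞}

theorem IsSymplecticCapacity.sympBall_le_cubeProdCrossPolytope (hc : IsSymplecticCapacity n c)
    {r : ℝ} (hr : r < 2 * Real.pi) :
    c (sympBall n r) ≤ c (.ofOpen (cubeProdCrossPolytope n (Real.pi / 2))) := by
  have hn : (0 : ℝ) < n := Nat.cast_pos.2 (NeZero.pos n)
  obtain ⟨k, hk, hnk⟩ : ∃ k > 0, r / Real.pi / 2 + n * k = 1 :=
    ⟨(2 * Real.pi - r) / (2 * Real.pi * n), by have := sub_pos.2 hr; positivity,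
      by field_simp; ring⟩
  refine hc.le_of_planeProd (e := 1) (fun _ _ _ => hasJacobianAt_poschlTellerMap hk _)
    (injective_planeProd fun _ => injective_poschlTellerMap hk).injOn
    fun x (hx : ∑ i, x.1 i ^ 2 + ∑ i, x.2 i ^ 2 < r / Real.pi) =>
      ⟨fun i => abs_fst_poschlTellerMap_lt hk _, ?_⟩
  calc ∑ i, |(poschlTellerMap k (x.1 i, x.2 i)).2|
      ≤ ∑ i, ((x.1 i ^ 2 + x.2 i ^ 2) / 2 + k) :=
        Finset.sum_le_sum fun i _ => abs_snd_poschlTellerMap_le hk _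
    _ = (∑ i, x.1 i ^ 2 + ∑ i, x.2 i ^ 2) / 2 + n * k := by
        simp [Finset.sum_add_distrib, ← Finset.sum_div]
    _ < r / Real.pi / 2 + n * k := by gcongr
    _ = 1 := hnk

theorem IsNormalizedSymplecticCapacity.two_pi_le_cubeProdCrossPolytope
    (hc : IsNormalizedSymplecticCapacity n c) :
    ENNReal.ofReal (2 * Real.pi) ≤ c (.ofOpen (cubeProdCrossPolytope n (Real.pi / 2))) := by
  refine le_of_forall_lt fun t ht => ?_
  obtain ⟨r, -, htr, hr⟩ := ENNReal.lt_iff_exists_real_btwn.1 ht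
  have hr₀ : 0 < r := ENNReal.ofReal_pos.1 (bot_le.trans_lt htr)
  exact htr.trans_le ((hc.ofReal_le_sympBall hr₀).trans (hc.sympBall_le_cubeProdCrossPolytope
    ((ENNReal.ofReal_lt_ofReal_iff Real.two_pi_pos).1 hr)))

theorem IsNormalizedSymplecticCapacity.four_mul_le_cubeProdCrossPolytope
    (hc : IsNormalizedSymplecticCapacity n c) {a : ℝ} (ha : 0 < a) :
    ENNReal.ofReal (4 * a) ≤ c (.ofOpen (cubeProdCrossPolytope n a)) := by
  have hb : 0 < a / (Real.pi / 2) := by positivity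
  have h := hc.ofReal_abs_mul_le_of_planeProd (e := 1) (l := a / (Real.pi / 2) * 1)
    (U := cubeProdCrossPolytope n (Real.pi / 2)) (V := cubeProdCrossPolytope n a) (by positivity)
    (fun _ _ _ => hasJacobianAt_diagAffine _ 0 1 0 _)
    (injective_planeProd fun _ => injective_diagAffine hb.ne' one_ne_zero 0 0).injOn
    fun x hx => ⟨fun i => ?_, by simpa [planeProd, diagAffine] using hx.2⟩
  · rw [mul_one, abs_of_pos hb] at h
    calc ENNReal.ofReal (4 * a)
        = ENNReal.ofReal (a / (Real.pi / 2)) * ENNReal.ofReal (2 * Real.pi) := by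
          rw [← ENNReal.ofReal_mul hb.le]
          congr 1
          field_simp
          ring
      _ ≤ _ := by grw [hc.two_pi_le_cubeProdCrossPolytope]
      _ ≤ _ := h
  · have hx₁ : |x.1 i| < Real.pi / 2 := hx.1 i
    simp only [planeProd, diagAffine, add_zero, abs_mul, abs_of_pos hb, Equiv.Perm.coe_one, id]
    rwa [div_mul_eq_mul_div, div_lt_iff₀ (by positivity), mul_lt_mul_iff_right₀ ha]

end

theorem hasJacobianAt_actionAngle_comp_diagAffine {b s c t : ℝ} (hbc : b * c = 1) {z : ℝ × ℝ}
    (hz : 0 < c * z.2 + t) : HasJacobianAt (actionAngle ∘ diagAffine b s c t) 1 z := by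
  simpa only [one_mul, hbc] using
    (hasJacobianAt_actionAngle hz).comp (hasJacobianAt_diagAffine b s c t z)

/-- The area preserving embedding of the rectangle `(-a, a) × (-1, 1)` into the disk of area `4a`
that rescales the rectangle to angles in `(-π, π)` and positive actions. -/
noncomputable def rectangleToDisk (a : ℝ) : ℝ × ℝ → ℝ × ℝ :=
  actionAngle ∘ diagAffine (Real.pi / a) 0 (a / Real.pi) (a / Real.pi)

section
variable {a : ℝ} (ha : 0 < a)
include ha

theorem diagAffine_mem_Ioo_prod_Ioo {z : ℝ × ℝ} (hz : |z.1| < a ∧ |z.2| < 1) :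
    diagAffine (Real.pi / a) 0 (a / Real.pi) (a / Real.pi) z ∈
      Ioo (-Real.pi) Real.pi ×ˢ Ioo 0 (2 * (a / Real.pi)) := by
  have hb : 0 < a / Real.pi := by positivity
  obtain ⟨hθ, hI⟩ := hz
  have hθ' : |Real.pi / a * z.1 + 0| < Real.pi := by
    rw [add_zero, abs_mul, abs_of_pos (by positivity), div_mul_eq_mul_div, div_lt_iff₀ ha]
    gcongr
  rw [abs_lt] at hI
  exact ⟨abs_lt.1 hθ', by simp only [diagAffine]; nlinarith, by simp only [diagAffine]; nlinarith⟩

theorem hasJacobianAt_rectangleToDisk {z : ℝ × ℝ} (hz : |z.1| < a ∧ |z.2| < 1) :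
    HasJacobianAt (rectangleToDisk a) 1 z :=
  hasJacobianAt_actionAngle_comp_diagAffine (by field_simp)
    (diagAffine_mem_Ioo_prod_Ioo ha hz).2.1

theorem injOn_rectangleToDisk : InjOn (rectangleToDisk a) {z | |z.1| < a ∧ |z.2| < 1} :=
  injOn_actionAngle.comp (injective_diagAffine (by positivity) (by positivity) _ _).injOn
    fun _ hz => prod_mono_right Ioo_subset_Ioi_self (diagAffine_mem_Ioo_prod_Ioo ha hz)

theorem sq_add_sq_rectangleToDisk_lt {z : ℝ × ℝ} (hz : |z.1| < a ∧ |z.2| < 1) :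
    (rectangleToDisk a z).1 ^ 2 + (rectangleToDisk a z).2 ^ 2 < 4 * a / Real.pi := by
  obtain ⟨-, hpos, hlt⟩ := diagAffine_mem_Ioo_prod_Ioo ha hz
  calc _ = 2 * (diagAffine (Real.pi / a) 0 (a / Real.pi) (a / Real.pi) z).2 :=
        sq_add_sq_actionAngle hpos.le
    _ < 2 * (2 * (a / Real.pi)) := by gcongr
    _ = 4 * a / Real.pi := by ring

end

/-- The product `{x_0² + y_0² < 4, |x_1| < a, |y_1| < 1}` of a disk and a rectangle. -/
def diskProdRectangle (a : ℝ) : TopologicalSpace.Opens (SympSpace 2) :=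
  ⟨{y | y.1 0 ^ 2 + y.2 0 ^ 2 < 4 ∧ |y.1 1| < a ∧ |y.2 1| < 1},
    .and (isOpen_lt (by fun_prop) continuous_const)
      (.and (isOpen_lt (by fun_prop) continuous_const)
        (isOpen_lt (by fun_prop) continuous_const))⟩

section
variable {c : SymplecticManifold 2 → ℝ≥0∞} {a : ℝ}

theorem IsNormalizedSymplecticCapacity.diskProdRectangle_le_four_pi
    (hc : IsNormalizedSymplecticCapacity 2 c) :
    c (.ofOpen (diskProdRectangle a)) ≤ ENNReal.ofReal (4 * Real.pi) := by
  have hsub : diskProdRectangle a ≤ coordCylinder 0 (4 * Real.pi) := fun y hy => by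
    change y.1 0 ^ 2 + y.2 0 ^ 2 < 4 * Real.pi / Real.pi
    rw [mul_div_cancel_right₀ _ Real.pi_ne_zero]
    exact hy.1
  exact (hc.mono_ofOpen hsub).trans (hc.coordCylinder_le 0 (by positivity))

theorem IsNormalizedSymplecticCapacity.diskProdRectangle_le_four_mul
    (hc : IsNormalizedSymplecticCapacity 2 c) (ha : 0 < a) :
    c (.ofOpen (diskProdRectangle a)) ≤ ENNReal.ofReal (4 * a) := by
  have hjac : ∀ y ∈ diskProdRectangle a, ∀ i : Fin 2,
      HasJacobianAt (![id, rectangleToDisk a] i) 1 (y.1 i, y.2 i) := fun y hy =>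
    Fin.forall_fin_two.2 ⟨hasJacobianAt_id _, hasJacobianAt_rectangleToDisk ha hy.2⟩
  have hinj : InjOn (planeProd 1 ![id, rectangleToDisk a]) (diskProdRectangle a) :=
    (injOn_planeProd (s := ![univ, {z | |z.1| < a ∧ |z.2| < 1}])
      (Fin.forall_fin_two.2 ⟨injOn_id _, injOn_rectangleToDisk ha⟩)).mono
        fun y hy => Fin.forall_fin_two.2 ⟨trivial, hy.2⟩
  exact (hc.le_of_planeProd hjac hinj fun y hy => sq_add_sq_rectangleToDisk_lt ha hy.2).trans
    (hc.coordCylinder_le 1 (by positivity))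

end

section
variable {a : ℝ}

theorem extChartAt_target_diskCotangentCylinder (x₀ : diskCotangentCylinder a) :
    (extChartAt 𝓘(ℝ, SympSpace 2) x₀).target = cylTarget a := by
  rw [extChartAt_target]
  exact inter_eq_left.2 fun y _ => by simp

theorem fderiv_comp_extChartAt_symm_diskCotangentCylinder {E : Type*} [NormedAddCommGroup E]
    [NormedSpace ℝ E] (F : SympSpace 3 → E) (x₀ : diskCotangentCylinder a) {y : SympSpace 2}
    (hy : y ∈ (extChartAt 𝓘(ℝ, SympSpace 2) x₀).target) :
    fderiv ℝ ((fun x : diskCotangentCylinder a => F x) ∘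
      (extChartAt 𝓘(ℝ, SympSpace 2) x₀).symm) y = fderiv ℝ (F ∘ cylParam (cylBase x₀)) y := by
  refine Filter.EventuallyEq.fderiv_eq ?_
  filter_upwards [(isOpen_extChartAt_target x₀).mem_nhds hy] with z hz
  rw [extChartAt_target_diskCotangentCylinder] at hz
  exact congrArg F (cylChart_symm_val x₀ hz)

theorem inChart_diskCotangentBundle_form (x₀ : diskCotangentCylinder a) {y : SympSpace 2}
    (hy : y ∈ (extChartAt 𝓘(ℝ, SympSpace 2) x₀).target) :
    inChart (diskCotangentBundle a).form x₀ y = stdForm 2 :=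
  ((pullbackStdForm_inChart (contMDiff_cylInclusion a) x₀ hy).trans
    (congrArg (stdForm 3).compContinuousLinearMap
      (fderiv_comp_extChartAt_symm_diskCotangentCylinder id x₀ hy))).trans
    (stdForm_fderiv_cylParam (norm_cylBase x₀) y)

theorem diskCotangentBundle_form (x : diskCotangentCylinder a) :
    (diskCotangentBundle a).form x = stdForm 2 :=
  ((pullbackStdForm_apply_chart (contMDiff_cylInclusion a) x).trans
    (congrArg (stdForm 3).compContinuousLinearMap
      (fderiv_comp_extChartAt_symm_diskCotangentCylinder id x (mem_extChartAt_target x)))).trans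
    (stdForm_fderiv_cylParam (norm_cylBase x) _)

theorem cubeProdCrossPolytope_subset_cylTarget {b : ℝ} (hba : b ≤ a) (hbπ : b ≤ Real.pi) :
    (cubeProdCrossPolytope 2 b : Set (SympSpace 2)) ⊆ cylTarget a := by
  rintro y ⟨hq, hp : ∑ i, |y.2 i| < 1⟩
  rw [Fin.sum_univ_two] at hp
  refine ⟨abs_lt.1 ((hq 0).trans_le hbπ), (hq 1).trans_le hba, ?_⟩
  rw [← sq_abs (y.2 0), ← sq_abs (y.2 1)]
  nlinarith [abs_nonneg (y.2 0), abs_nonneg (y.2 1)]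

theorem IsNormalizedSymplecticCapacity.le_diskCotangentBundle {c : SymplecticManifold 2 → ℝ≥0∞}
    (hc : IsNormalizedSymplecticCapacity 2 c) (ha : 0 < a) :
    ENNReal.ofReal (4 * min a Real.pi) ≤ c (diskCotangentBundle a) := by
  let x₀ : diskCotangentCylinder a := ⟨cylParam 1 0, cylParam_mem (by simp) (by simpa) (by simp)⟩
  have hsub : (cubeProdCrossPolytope 2 (min a Real.pi) : Set (SympSpace 2)) ⊆ cylTarget a :=
    cubeProdCrossPolytope_subset_cylTarget (min_le_left _ _) (min_le_right _ _)
  exact (hc.four_mul_le_cubeProdCrossPolytope (lt_min ha Real.pi_pos)).trans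
    (hc.monotone _ _ (exists_isSymplecticEmbedding_of_inChart_eq_stdForm
      (M := diskCotangentBundle a) (x₀ := x₀) hsub fun y hy =>
        inChart_diskCotangentBundle_form x₀
          ((extChartAt_target_diskCotangentCylinder x₀).symm ▸ hsub hy)))

end

/-- The momentum `p_θ` conjugate to the angle `θ` around the third axis. -/
def angularMomentum (x : SympSpace 3) : ℝ := x.1 0 * x.2 1 - x.1 1 * x.2 0

/-- On `D^*C_a`, the coordinates `(z, p_z)` together with the plane point of action `p_θ + 1` and
angle `θ`. The shift by `1` makes the action positive. -/
noncomputable def cylPolar (x : SympSpace 3) : SympSpace 2 :=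
  (![√(2 * (angularMomentum x + 1)) * x.1 1, x.1 2],
    ![√(2 * (angularMomentum x + 1)) * x.1 0, x.2 2])

theorem angularMomentum_cylParam {w : ℂ} (hw : ‖w‖ = 1) (y : SympSpace 2) :
    angularMomentum (cylParam w y) = y.2 0 := by
  have hw' : w.re * w.re + w.im * w.im = 1 := by
    rw [← Complex.normSq_apply, Complex.normSq_eq_norm_sq, hw, one_pow]
  simp only [angularMomentum, cylParam, Matrix.cons_val_zero, Matrix.cons_val_one]
  linear_combination y.2 0 * (Real.sin (y.1 0) ^ 2 + Real.cos (y.1 0) ^ 2) * hw' +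
    y.2 0 * Real.sin_sq_add_cos_sq (y.1 0)

theorem cylPolar_comp_cylParam {w : ℂ} (hw : ‖w‖ = 1) :
    cylPolar ∘ cylParam w = planeProd 1 ![actionAngle ∘ diagAffine 1 w.arg 1 1, id] := by
  have hre : w.re = Real.cos w.arg := by rw [← Complex.norm_mul_cos_arg w, hw, one_mul]
  have him : w.im = Real.sin w.arg := by rw [← Complex.norm_mul_sin_arg w, hw, one_mul]
  funext y
  rw [Function.comp_apply, cylPolar, angularMomentum_cylParam hw]
  refine Prod.ext (funext fun i => ?_) (funext fun i => ?_) <;> fin_cases i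
  · change √(2 * (y.2 0 + 1)) * (w.re * Real.sin (y.1 0) + w.im * Real.cos (y.1 0)) =
      √(2 * (1 * y.2 0 + 1)) * Real.sin (1 * y.1 0 + w.arg)
    rw [one_mul, one_mul, Real.sin_add, ← hre, ← him]
    ring
  · rfl
  · change √(2 * (y.2 0 + 1)) * (w.re * Real.cos (y.1 0) - w.im * Real.sin (y.1 0)) =
      √(2 * (1 * y.2 0 + 1)) * Real.cos (1 * y.1 0 + w.arg)
    rw [one_mul, one_mul, Real.cos_add, ← hre, ← him]
    ring
  · rfl

theorem stdForm_fderiv_cylPolar_comp_cylParam {w : ℂ} (hw : ‖w‖ = 1) {y : SympSpace 2}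
    (hy : 0 < y.2 0 + 1) :
    (stdForm 2).compContinuousLinearMap (fderiv ℝ (cylPolar ∘ cylParam w) y) = stdForm 2 := by
  have hjac : ∀ i : Fin 2, HasJacobianAt (![actionAngle ∘ diagAffine 1 w.arg 1 1, id] i) 1
      (y.1 i, y.2 i) :=
    Fin.forall_fin_two.2 ⟨hasJacobianAt_actionAngle_comp_diagAffine (one_mul 1)
      (by rwa [one_mul]), hasJacobianAt_id _⟩
  rw [cylPolar_comp_cylParam hw]
  exact (stdForm_fderiv_planeProd hjac).trans (one_smul ℝ _)

section
variable {a : ℝ} {x : SympSpace 3}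

theorem sq_angularMomentum_add_sq_lt (hx : x ∈ diskCotangentCylinder a) :
    angularMomentum x ^ 2 + x.2 2 ^ 2 < 1 := by
  obtain ⟨⟨hq, -⟩, htangent, hnorm⟩ := hx
  have : angularMomentum x ^ 2 = x.2 0 ^ 2 + x.2 1 ^ 2 := by
    rw [angularMomentum]
    linear_combination (x.2 0 ^ 2 + x.2 1 ^ 2) * hq - (x.1 0 * x.2 0 + x.1 1 * x.2 1) * htangent
  linarith

theorem abs_angularMomentum_lt (hx : x ∈ diskCotangentCylinder a) : |angularMomentum x| < 1 := by
  rw [← sq_lt_one_iff_abs_lt_one]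
  linarith [sq_angularMomentum_add_sq_lt hx, sq_nonneg (x.2 2)]

theorem abs_axialMomentum_lt (hx : x ∈ diskCotangentCylinder a) : |x.2 2| < 1 := by
  rw [← sq_lt_one_iff_abs_lt_one]
  linarith [sq_angularMomentum_add_sq_lt hx, sq_nonneg (angularMomentum x)]

theorem angularMomentum_add_one_pos (hx : x ∈ diskCotangentCylinder a) :
    0 < angularMomentum x + 1 := by
  linarith [(abs_lt.1 (abs_angularMomentum_lt hx)).1]

theorem sq_add_sq_cylPolar (hx : x ∈ diskCotangentCylinder a) :
    (cylPolar x).1 0 ^ 2 + (cylPolar x).2 0 ^ 2 = 2 * (angularMomentum x + 1) := by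
  have hL := angularMomentum_add_one_pos hx
  have hsq : √(2 * (angularMomentum x + 1)) ^ 2 = 2 * (angularMomentum x + 1) :=
    Real.sq_sqrt (by positivity)
  simp only [cylPolar, Matrix.cons_val_zero]
  linear_combination (x.1 0 ^ 2 + x.1 1 ^ 2) * hsq + 2 * (angularMomentum x + 1) * hx.1.1

theorem contDiffAt_cylPolar (hx : x ∈ diskCotangentCylinder a) : ContDiffAt ℝ ∞ cylPolar x := by
  have hL := angularMomentum_add_one_pos hx
  have hsqrt : ContDiffAt ℝ ∞ (fun x : SympSpace 3 => √(2 * (angularMomentum x + 1))) x :=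
    ContDiffAt.sqrt (ContDiff.contDiffAt (by unfold angularMomentum; fun_prop)) (by positivity)
  refine ContDiffAt.prodMk (contDiffAt_pi.2 fun i => ?_) (contDiffAt_pi.2 fun i => ?_) <;>
    fin_cases i
  · exact hsqrt.mul (ContDiff.contDiffAt (by fun_prop))
  · exact ContDiff.contDiffAt (f := fun x : SympSpace 3 => x.1 2) (by fun_prop)
  · exact hsqrt.mul (ContDiff.contDiffAt (by fun_prop))
  · exact ContDiff.contDiffAt (f := fun x : SympSpace 3 => x.2 2) (by fun_prop)

theorem eq_of_angularMomentum_eq {x' : SympSpace 3} (hx : x ∈ diskCotangentCylinder a)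
    (hx' : x' ∈ diskCotangentCylinder a) (hq : x.1 = x'.1)
    (hL : angularMomentum x = angularMomentum x') (hp : x.2 2 = x'.2 2) : x = x' := by
  have hp₀ {x : SympSpace 3} (hx : x ∈ diskCotangentCylinder a) :
      x.2 0 = -(angularMomentum x * x.1 1) := by
    rw [angularMomentum]
    linear_combination x.1 0 * hx.2.1 - x.2 0 * hx.1.1
  have hp₁ {x : SympSpace 3} (hx : x ∈ diskCotangentCylinder a) :
      x.2 1 = angularMomentum x * x.1 0 := by
    rw [angularMomentum]
    linear_combination x.1 1 * hx.2.1 - x.2 1 * hx.1.1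
  refine Prod.ext hq (funext fun i => ?_)
  fin_cases i
  · exact (hp₀ hx).trans ((by rw [hq, hL] : _ = _).trans (hp₀ hx').symm)
  · exact (hp₁ hx).trans ((by rw [hq, hL] : _ = _).trans (hp₁ hx').symm)
  · exact hp

theorem injOn_cylPolar : InjOn cylPolar (diskCotangentCylinder a) := by
  intro x hx x' hx' h
  have hL : angularMomentum x = angularMomentum x' := by
    have := sq_add_sq_cylPolar hx
    rw [h, sq_add_sq_cylPolar hx'] at this
    linarith
  have hR : √(2 * (angularMomentum x' + 1)) ≠ 0 :=
    (Real.sqrt_pos.2 (by linarith [angularMomentum_add_one_pos hx'])).ne'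
  simp only [cylPolar, hL, Prod.mk.injEq, Matrix.vecCons_inj, mul_right_inj' hR, and_true] at h
  obtain ⟨⟨hq₁, hq₂⟩, hq₀, hp⟩ := h
  refine eq_of_angularMomentum_eq hx hx' (funext fun i => ?_) hL hp
  fin_cases i
  exacts [hq₀, hq₁, hq₂]

end

theorem exists_isSymplecticEmbedding_diskProdRectangle (a : ℝ) :
    ∃ φ, IsSymplecticEmbedding (diskCotangentBundle a) (.ofOpen (diskProdRectangle a)) φ := by
  have hsmooth : ContMDiff 𝓘(ℝ, SympSpace 2) 𝓘(ℝ, SympSpace 2) ∞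
      (fun x : diskCotangentCylinder a => cylPolar x) := fun x =>
    ContMDiffAt.comp x (contDiffAt_cylPolar x.2).contMDiffAt
      (contMDiff_cylInclusion a).contMDiffAt
  refine exists_isSymplecticEmbedding_ofOpen (M := diskCotangentBundle a)
    (F := fun x : diskCotangentCylinder a => cylPolar x) hsmooth
    (injOn_iff_injective.1 injOn_cylPolar)
    (fun x : diskCotangentCylinder a => ⟨?_, x.2.1.2, abs_axialMomentum_lt x.2⟩)
    fun x : diskCotangentCylinder a => ?_
  · change (cylPolar x).1 0 ^ 2 + (cylPolar x).2 0 ^ 2 < 4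
    rw [sq_add_sq_cylPolar x.2]
    linarith [(abs_lt.1 (abs_angularMomentum_lt x.2)).2]
  · have hmem := mem_extChartAt_target (I := 𝓘(ℝ, SympSpace 2)) x
    have hnorm := (extChartAt_target_diskCotangentCylinder x ▸ hmem).2.2
    refine (((pullbackStdForm_apply_chart hsmooth x).trans
      (congrArg (stdForm 2).compContinuousLinearMap
        (fderiv_comp_extChartAt_symm_diskCotangentCylinder cylPolar x hmem))).trans
      (stdForm_fderiv_cylPolar_comp_cylParam (norm_cylBase x) ?_)).trans
      (diskCotangentBundle_form x).symm
    nlinarith [sq_nonneg ((extChartAt 𝓘(ℝ, SympSpace 2) x x).2 1)]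

theorem IsNormalizedSymplecticCapacity.diskCotangentBundle_eq
    {c : SymplecticManifold 2 → ℝ≥0∞} (hc : IsNormalizedSymplecticCapacity 2 c) {a : ℝ}
    (ha : 0 < a) :
    c (diskCotangentBundle a) = ENNReal.ofReal (4 * min a Real.pi) := by
  refine le_antisymm ?_ (hc.le_diskCotangentBundle ha)
  rw [mul_min_of_nonneg _ _ zero_le_four, ENNReal.ofReal_min]
  exact (hc.monotone _ _ (exists_isSymplecticEmbedding_diskProdRectangle a)).trans
    (le_min (hc.diskProdRectangle_le_four_mul ha) hc.diskProdRectangle_le_four_pi)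

theorem mainTheorem5 (c : SymplecticManifold 2 → ℝ≥0∞) (hc : IsNormalizedSymplecticCapacity 2 c)
    (a : ℝ) (ha : 0 < a) :
    (a ≤ Real.pi → c (diskCotangentBundle a) = ENNReal.ofReal (4 * a)) ∧
    (Real.pi ≤ a → c (diskCotangentBundle a) = ENNReal.ofReal (4 * Real.pi)) := by
  have h := hc.diskCotangentBundle_eq ha
  exact ⟨fun haπ => by rw [h, min_eq_left haπ], fun hπa => by rw [h, min_eq_right hπa]⟩
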